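/- Let $G=(\mathcal V,\mathcal E)$ be a finite connected simple graph with positive symmetric edge weights $w_{xy}$ ($w_{xy}=0$ if $xy\notin\mathcal E$), $\deg(x)=\sum_y w_{xy}$, and let $\phi$ be a $\mathrm U(1)$-connection on $G$: unit complex numbers $\phi_{xy}$, one for each oriented edge $xy$, with $\phi_{yx}=\overline{\phi_{xy}}$. The magnetic Laplacian is the $\mathcal V\times\mathcal V$ matrix $\mathsf\Delta$ with $\mathsf\Delta_{xx}=\deg(x)$ and $\mathsf\Delta_{xy}=-w_{xy}\phi_{xy}$ for $x\neq y$; $\mathsf\Delta_{\overline{\mathcal S}}$ denotes $\mathsf\Delta$ with the rows and columns indexed by $\mathcal S$ removed (the empty determinant is $1$). An oriented cycle is a minimal closed path $c=(x_0,\dots,x_{k-1},x_0)$ in $G$ with $k\ge 2$ (backtracks, $k=2$, are included), up to the choice of the base node; its holonomy is $\phi_{x_0x_1}\cdots\phi_{x_{k-1}x_0}=\exp(-\mathrm i\,\theta(c))$, and $\alpha(c)=1-\cos\theta(c)$. Assume that some cycle has holonomy different from $1$ and that $\cos\theta(c)\ge 0$ for every cycle $c$. An oriented CRSF (cycle-rooted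 spanning forest) is a spanning subgraph $\mathcal F$ of $G$ whose edges are oriented (each in one direction only), each connected component of which has a unique cycle, this cycle being oriented and all edges being directed towards it. Set $$\mu_{\mathrm{CRSF}}(\mathcal F)=\frac1{\det\mathsf\Delta}\prod_{e\in\mathcal F}w_e\prod_{\text{oriented cycles }c\subseteq\mathcal F}\bigl(1-\cos\theta(c)\bigr).$$ Fix a total ordering $\iota$ of the nodes. The algorithm CyclePopping uses independent random walks $(X^x_n)_{n\ge0}$, $x\in\mathcal V$, where $X^x$ starts at $x$ and has transition probabilities $w_{yz}/\deg(y)$, and independent Bernoulli variables $B^x_{c,n}$ with success probability $\alpha(c)$, for all nodes $x$, oriented cycles $c$ and $n\ge 0$, independent of the walks. It starts with the empty graph $\mathcal T_0$. While the node set of $\mathcal T_\ell$ is not $\mathcal V$, it takes the first node $x$, in the order $\iota$, that is not in $\mathcal T_\ell$, and runs $X^x$, chronologically erasing each cycle when it is formed, until the first time $n$ at which either the walk hits $\mathcal T_\ell$ or an oriented cycle $c$ is formed (the walk steps back onto its current loop-erased path, closing $c$) with $B^x_{c,n}=1$ (the cycle is accepted and not erased). The resulting oriented branch or lasso (the loop-erased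 path followed by the last step) is added to $\mathcal T_\ell$, which gives $\mathcal T_{\ell+1}$. When all nodes are covered, the last $\mathcal T_\ell$ is returned. For an oriented CRSF $\mathcal F$, let $\mathcal F_0=\emptyset$ and, as long as $\mathcal F_\ell$ does not cover $\mathcal V$, let $\mathcal F_{\ell+1}$ be $\mathcal F_\ell$ together with the nodes and edges of $\mathcal F$ met when following the arrows of $\mathcal F$ from the first node, in the order $\iota$, that is not in $\mathcal F_\ell$. Let $\mathcal V_\ell$ be the node set of $\mathcal F_\ell$, and $\kappa_\iota(\mathcal F)$ the first $\ell$ with $\mathcal V_\ell=\mathcal V$. Then $\det\mathsf\Delta\neq0$, and for every oriented CRSF $\mathcal F$ with $\mu_{\mathrm{CRSF}}(\mathcal F)\ne 0$ and every $1\le\ell\le\kappa_\iota(\mathcal F)$, $$\mathbb P(\mathcal T_\ell=\mathcal F_\ell)=\mathbb P(\mathcal T_1=\mathcal F_1,\dots,\mathcal T_\ell=\mathcal F_\ell)=\frac{\det(\mathsf\Delta_{\overline{\mathcal V_\ell}})}{\det\mathsf\Delta}\prod_{e\in\mathcal F_\ell}w_e\prod_{\text{oriented cycles }c\subseteq\mathcal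 F_\ell}\bigl(1-\cos\theta(c)\bigr).$$ In particular, the algorithm almost surely terminates, its output is almost surely an oriented CRSF, and each oriented CRSF $\mathcal F$ is returned with probability $\mu_{\mathrm{CRSF}}(\mathcal F)$. -/

import Mathlib

open MeasureTheory ProbabilityTheory

noncomputable section

namespace CyclePopping

universe u v

/-! ### Oriented cycles -/

/-- The arcs of the cyclic sequence `(x₀, …, x_{k-1}, x₀)`:
`(x₀, x₁), …, (x_{k-2}, x_{k-1}), (x_{k-1}, x₀)`, with multiplicity. -/
def cycleArcs {V : Type u} (c : Cycle V) : Multiset (V × V) :=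
  Quotient.liftOn' c (fun l => ((l.zip (l.rotate 1) : List (V × V)) : Multiset (V × V))) (by
    rintro l _ ⟨n, rfl⟩
    have h : (l.rotate n).zip ((l.rotate n).rotate 1) = (l.zip (l.rotate 1)).rotate n := by
      rw [List.rotate_rotate, Nat.add_comm n 1, ← List.rotate_rotate]
      simp only [List.zip]
      exact (List.zipWith_rotate_distrib Prod.mk l (l.rotate 1) n (by simp)).symm
    change ((l.zip (l.rotate 1) : List (V × V)) : Multiset (V × V))
      = (((l.rotate n).zip ((l.rotate n).rotate 1) : List (V × V)) : Multiset (V × V))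
    rw [h]
    exact (Multiset.coe_eq_coe.2 (List.rotate_perm _ _)).symm)

/-- The oriented cycles of `G`: minimal loops of `G` of length at least two (the backtracks
`(x, y, x)` included), up to a change of base node. -/
def OrientedCycle {V : Type u} (G : SimpleGraph V) : Type u :=
  {c : Cycle V // c.Nodup ∧ 2 ≤ c.length ∧ ∀ a ∈ cycleArcs c, G.Adj a.1 a.2}

/-- The arcs of an oriented cycle. -/
def OrientedCycle.arcs {V : Type u} {G : SimpleGraph V} (c : OrientedCycle G) :
    Multiset (V × V) :=
  cycleArcs c.1

instance instFiniteOrientedCycle {V : Type u} [Fintype V] [DecidableEq V] (G : SimpleGraph V) :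
    Finite (OrientedCycle G) :=
  Finite.of_injective
    (fun c : OrientedCycle G => (⟨c.1, c.2.1⟩ : {s : Cycle V // s.Nodup}))
    (fun _ _ h => Subtype.ext (congrArg (fun s : {s : Cycle V // s.Nodup} => s.1) h))

instance instFintypeOrientedCycle {V : Type u} [Fintype V] [DecidableEq V] (G : SimpleGraph V) :
    Fintype (OrientedCycle G) :=
  Fintype.ofFinite _

/-! ### Edge weights, connections, magnetic Laplacian -/

/-- Symmetric edge weights, positive on the edges and zero elsewhere. -/
structure EdgeWeights {V : Type u} (G : SimpleGraph V) where
  /-- the weight `w_{xy}` -/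
  w : V → V → ℝ
  symm : ∀ x y, w x y = w y x
  pos : ∀ x y, G.Adj x y → 0 < w x y
  zero : ∀ x y, ¬ G.Adj x y → w x y = 0

/-- A `U(1)`-connection: a phase on each oriented edge, inverted when the edge is reversed. (The
values of `phase` at pairs that are not edges are never used.) -/
structure Connection {V : Type u} (G : SimpleGraph V) where
  /-- the phase `φ_{xy}` -/
  phase : V → V → Circle
  inv : ∀ x y, G.Adj x y → phase y x = (phase x y)⁻¹

section Laplacian

variable {V : Type u} {G : SimpleGraph V}

/-- The holonomy of an oriented cycle: the product of the phases along it. -/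
def hol (φ : Connection G) (c : OrientedCycle G) : Circle :=
  (c.arcs.map fun a => φ.phase a.1 a.2).prod

/-- The angle `θ(c)`, determined modulo `2π` by `hol(c) = exp(-i θ(c))`. -/
def theta (φ : Connection G) (c : OrientedCycle G) : ℝ :=
  -Complex.arg (hol φ c : ℂ)

/-- The acceptance probability `α(c) = 1 - cos θ(c)` of an oriented cycle. -/
def alpha (φ : Connection G) (c : OrientedCycle G) : ℝ :=
  1 - Real.cos (theta φ c)

/-- Some cycle has a holonomy different from one. -/
def Nontrivial (φ : Connection G) : Prop :=
  ∃ c : OrientedCycle G, hol φ c ≠ 1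

/-- All cycles are weakly inconsistent. -/
def WeaklyInconsistent (φ : Connection G) : Prop :=
  ∀ c : OrientedCycle G, 0 ≤ Real.cos (theta φ c)

/-- Weighted degree. -/
def deg [Fintype V] (W : EdgeWeights G) (x : V) : ℝ :=
  ∑ y, W.w x y

/-- Transition probability of the random walk. -/
def transProb [Fintype V] (W : EdgeWeights G) (x y : V) : ℝ :=
  W.w x y / deg W x

/-- The magnetic Laplacian `Δ = D - W ⊙ Φ`. -/
def laplacian [Fintype V] [DecidableEq V] (W : EdgeWeights G) (φ : Connection G) :
    Matrix V V ℂ :=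
  Matrix.diagonal (fun x => (deg W x : ℂ)) -
    Matrix.of (fun x y => (W.w x y : ℂ) * (φ.phase x y : ℂ))

/-- The matrix `M` with the rows and columns indexed by `S` removed. -/
def removeRowsCols (M : Matrix V V ℂ) (S : Finset V) : Matrix {x // x ∉ S} {x // x ∉ S} ℂ :=
  M.submatrix Subtype.val Subtype.val

end Laplacian

/-! ### Oriented subgraphs and oriented cycle-rooted spanning forests -/

/-- An oriented subgraph: a set of nodes and a set of oriented edges. -/
@[ext]
structure OrientedSubgraph (V : Type u) where
  nodes : Finset V
  arcs : Finset (V × V)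

section Subgraphs

variable {V : Type u} {G : SimpleGraph V}

/-- The empty subgraph. -/
def OrientedSubgraph.empty (V : Type u) : OrientedSubgraph V := ⟨∅, ∅⟩

/-- Union of two subgraphs. -/
def OrientedSubgraph.union [DecidableEq V] (S T : OrientedSubgraph V) : OrientedSubgraph V :=
  ⟨S.nodes ∪ T.nodes, S.arcs ∪ T.arcs⟩

/-- All arcs of the oriented cycle `c` belong to `F`. -/
def OrientedCycle.IsIn (c : OrientedCycle G) (F : Finset (V × V)) : Prop :=
  ∀ a ∈ c.arcs, a ∈ F

/-- `x` and `y` are in the same connected component of the spanning subgraph with arc set `F`,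
orientations being forgotten. -/
def SameComponent (F : Finset (V × V)) (x y : V) : Prop :=
  (SimpleGraph.fromRel fun a b => (a, b) ∈ F).Reachable x y

/-- There is an oriented path (possibly of length zero) from `x` to `y` in `F`. -/
def Leads (F : Finset (V × V)) (x y : V) : Prop :=
  Relation.ReflTransGen (fun a b => (a, b) ∈ F) x y

/-- `F` is the arc set of an oriented cycle-rooted spanning forest of `G`: a spanning subgraph,
each of whose edges carries one orientation, each of whose components has exactly one oriented
cycle, all edges being directed towards it. Each node has exactly one outgoing arc: the one
that leads towards the cycle, or along it. -/
structure IsOrientedCRSF (G : SimpleGraph V) (F : Finset (V × V)) : Prop where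
  adj : ∀ a ∈ F, G.Adj a.1 a.2
  asymm : ∀ x y, (x, y) ∈ F → (y, x) ∉ F
  existsUnique_out : ∀ x, ∃! y, (x, y) ∈ F
  existsUnique_cycle : ∀ x, ∃! c : OrientedCycle G, c.IsIn F ∧ ∀ v ∈ c.1, SameComponent F x v
  toward : ∀ x (c : OrientedCycle G), c.IsIn F → (∀ v ∈ c.1, SameComponent F x v) →
    ∃ v ∈ c.1, Leads F x v

open Classical in
/-- `∏_{e ∈ F} w_e × ∏_{oriented cycles c ⊆ F} (1 - cos θ(c))`. -/
def forestWeight [Fintype V] [DecidableEq V] (W : EdgeWeights G) (φ : Connection G)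
    (F : Finset (V × V)) : ℂ :=
  (∏ a ∈ F, (W.w a.1 a.2 : ℂ)) *
    ∏ c : OrientedCycle G with c.IsIn F, ((1 - Real.cos (theta φ c) : ℝ) : ℂ)

/-- Kenyon's measure of an oriented cycle-rooted spanning forest `F`. -/
def crsfMeasure [Fintype V] [DecidableEq V] (W : EdgeWeights G) (φ : Connection G)
    (F : Finset (V × V)) : ℂ :=
  1 / (laplacian W φ).det * forestWeight W φ F

/-! ### Stages of a fixed oriented cycle-rooted spanning forest -/

/-- The first node, in the ordering `ι`, that is not in `S` (`none` if there is none). -/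
def firstMissing [Fintype V] [DecidableEq V] (ι : Fin (Fintype.card V) ≃ V) (S : Finset V) :
    Option V :=
  ((List.finRange (Fintype.card V)).map ι).find? (fun x => decide (x ∉ S))

open Classical in
/-- The part of `F` that one sees when following the arcs of `F` from `x`. -/
def trail [Fintype V] (F : Finset (V × V)) (x : V) : OrientedSubgraph V :=
  ⟨Finset.univ.filter (fun y => Leads F x y), F.filter (fun a => Leads F x a.1)⟩

/-- The stages `F_0 = ∅, F_1, F_2, …` of `F`: each is obtained from the previous one by adding the
trail of the first missing node, which joins this node to a cycle of `F` or to the previous stage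
(of whose arcs the remainder of the trail then consists). -/
def stage [Fintype V] [DecidableEq V] (ι : Fin (Fintype.card V) ≃ V) (F : Finset (V × V)) :
    ℕ → OrientedSubgraph V
  | 0 => OrientedSubgraph.empty V
  | l + 1 =>
    match firstMissing ι (stage ι F l).nodes with
    | none => stage ι F l
    | some x => (stage ι F l).union (trail F x)

/-- The number `κ_ι(F)` of stages of `F`: the first index at which all nodes are covered. -/
def numStages [Fintype V] [DecidableEq V] (ι : Fin (Fintype.card V) ≃ V) (F : Finset (V × V)) :
    ℕ :=
  sInf {l | (stage ι F l).nodes = Finset.univ}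

end Subgraphs

/-! ### Chronological loop erasure and stopping times of one trajectory -/

section Walk

variable {V : Type u} [DecidableEq V] {G : SimpleGraph V}

/-- The chronological loop erasure of `(X_0, …, X_n)`: when the walk comes back to a node `y` of
the current path, everything after `y` is erased; otherwise the new node is appended. (If `y` is
not in the list, `takeWhile (· ≠ y)` is the whole list.) -/
def loopErasure (X : ℕ → V) : ℕ → List V
  | 0 => [X 0]
  | n + 1 => (loopErasure X n).takeWhile (fun z => decide (z ≠ X (n + 1))) ++ [X (n + 1)]

/-- The walk forms the oriented cycle `c` at time `n`: its `n`-th step goes back to a node `y` of the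
current loop-erased path, and `c` runs along this path from `y` to its end, then back to `y`. (If
`y` is not in the list, `dropWhile (· ≠ y)` is empty and no cycle is formed.) -/
def FormsCycle (X : ℕ → V) (c : OrientedCycle G) : ℕ → Prop
  | 0 => False
  | n + 1 => c.1 = ((loopErasure X n).dropWhile (fun z => decide (z ≠ X (n + 1))) : Cycle V)

/-- First time at which the walk is in `A`. -/
def hittingTime (A : Finset V) (X : ℕ → V) : ℕ∞ :=
  ⨅ (n : ℕ) (_ : X n ∈ A), (n : ℕ∞)

/-- First time at which the cycle `c` is formed and accepted. -/
def cycleTime (X : ℕ → V) (b : OrientedCycle G → ℕ → Bool) (c : OrientedCycle G) : ℕ∞ :=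
  ⨅ (n : ℕ) (_ : FormsCycle X c n ∧ b c n = true), (n : ℕ∞)

/-- First time at which the walk hits `A` or a cycle is accepted. -/
def stopTime (A : Finset V) (X : ℕ → V) (b : OrientedCycle G → ℕ → Bool) : ℕ∞ :=
  hittingTime A X ⊓ ⨅ c : OrientedCycle G, cycleTime X b c

/-- The loop-erased path before the last of `n` steps, followed by that step. -/
def lastPath (X : ℕ → V) : ℕ → List V
  | 0 => [X 0]
  | n + 1 => loopErasure X n ++ [X (n + 1)]

/-- The nodes and arcs of an oriented path. -/
def ofPath (l : List V) : OrientedSubgraph V :=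
  ⟨l.toFinset, (l.zip l.tail).toFinset⟩

open Classical in
/-- The branch or lasso left by the walk at its stopping time (`none` if it never stops). -/
def branch (A : Finset V) (X : ℕ → V) (b : OrientedCycle G → ℕ → Bool) :
    Option (OrientedSubgraph V) :=
  if stopTime A X b = ⊤ then none else some (ofPath (lastPath X (stopTime A X b).toNat))

end Walk

/-! ### The algorithm -/

section Algorithm

variable {V : Type u} [Fintype V] [DecidableEq V] {G : SimpleGraph V}

/-- The stages `T_0 = ∅, T_1, T_2, …` of the algorithm, run with the node ordering `ι`, the
trajectories `X x` (one for each starting node `x`) and the acceptance bits `b x c n`. The value is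
`none` at indices that the run does not reach, because all nodes are already covered or because some
earlier walk never stops. -/
def run (ι : Fin (Fintype.card V) ≃ V) (X : V → ℕ → V) (b : V → OrientedCycle G → ℕ → Bool) :
    ℕ → Option (OrientedSubgraph V)
  | 0 => some (OrientedSubgraph.empty V)
  | l + 1 =>
    (run ι X b l).bind fun T =>
      (firstMissing ι T.nodes).bind fun x =>
        (branch T.nodes (X x) (b x)).map fun J => T.union J

/-- The algorithm terminates and returns the spanning subgraph with arc set `F`. -/
def Returns (ι : Fin (Fintype.card V) ≃ V) (X : V → ℕ → V) (b : V → OrientedCycle G → ℕ → Bool)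
    (F : Finset (V × V)) : Prop :=
  ∃ l, run ι X b l = some ⟨Finset.univ, F⟩

/-- The randomness used by the algorithm: for each node `x`, a random walk `X x` started at `x` with
transition probabilities `w_{yz} / deg(y)`, and for each `x` and each oriented cycle `c`, a sequence of
Bernoulli variables with success probability `α(c)`; all walks and all Bernoulli variables are
independent. -/
structure IsDriving [MeasurableSpace V] (W : EdgeWeights G) (φ : Connection G)
    {Ω : Type v} [MeasurableSpace Ω] (μ : Measure Ω)
    (X : V → ℕ → Ω → V) (B : V → OrientedCycle G → ℕ → Ω → Bool) : Prop where
  measurable_walk : ∀ x n, Measurable (X x n)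
  measurable_bit : ∀ x c n, Measurable (B x c n)
  /-- the law of each walk, given by the probabilities of finite trajectories -/
  walk_law : ∀ (x : V) (n : ℕ) (y : ℕ → V),
    μ {ω | ∀ i ≤ n, X x i ω = y i} =
      if y 0 = x then ∏ i ∈ Finset.range n, ENNReal.ofReal (transProb W (y i) (y (i + 1))) else 0
  bit_law : ∀ x c n, μ {ω | B x c n ω = true} = ENNReal.ofReal (alpha φ c)
  /-- for each node, the Bernoulli variables are independent, … -/
  indep_bits : ∀ x, iIndepFun (fun (i : OrientedCycle G × ℕ) ω => B x i.1 i.2 ω) μ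
  /-- … they are jointly independent of the walk … -/
  indep_walk_bits : ∀ x, IndepFun (fun ω n => X x n ω) (fun ω c n => B x c n ω) μ
  /-- … and the data of distinct nodes are independent. -/
  indep_nodes : iIndepFun (fun x ω => ((fun n => X x n ω), (fun c n => B x c n ω))) μ

end Algorithm

end CyclePopping

end

/-!
The loop-erased path of a walk started at `x`, killed when it hits the set `A` of nodes already
covered or when a cycle is accepted, is itself a Markov chain on the finite set of self-avoiding
paths that avoid `A`: a step appends a node, or closes a cycle `c` which is erased with probability
`1 - α(c) = cos θ(c)`. The expected number of visits of a path `γ` by this chain is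
`∏ w · deg(last node) · det Δ_{A ∪ γ} / det Δ_A`, where the product runs over the arcs of `γ` and
`Δ_S` is the Laplacian with the rows and columns of `S` removed. This function solves the linear
equation of the expected numbers of visits (`visits_fixedPoint`), because the determinant can be
expanded along the cycles through a node `y`,
`deg(y) det Δ_{S ∪ y} = det Δ_S + ∑ w(c) hol(c) det Δ_{S ∪ c}` (`det_pinned_eq_sum_cycles`): as the
Laplacian is Hermitian, all its principal minors are real, and the real part of this identity has
`cos θ(c)` in place of the holonomy (`deg_mul_removedDet`). The Laplacian is positive definite
(`laplacian_posDef`), so that the candidate is positive; a nonnegative solution whose support is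
reached by the chain is the sum of the iterates of the initial law (`hasSum_of_fixedPoint`). Hence
the visits are summable, which gives the almost sure termination (`ae_exists_not_alive`), and the
law of a branch or lasso follows by summing over its last step (`measureReal_stopsWith`).

A subgraph of a forest `F` built by the algorithm is determined by the set of nodes it covers, since
every node has exactly one outgoing arc in `F`: this gives the equality of the events
`{T_ℓ = F_ℓ}` and `{T_1 = F_1, …, T_ℓ = F_ℓ}`, and rewrites them in terms of the branches of the
successive walks. These are independent, being driven by distinct nodes, and the ratios of
determinants telescope (`measureReal_run_eq_stage`). At the last stage all nodes are covered and the
remaining determinant is empty. Finally, in a graph in which each node has one outgoing arc and no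
edge is traversed in both directions, each component has exactly one cycle, towards which all arcs
point (`isOrientedCRSF_of_isGraphOf`); the second condition holds because a backtrack has trivial
holonomy and is never accepted.
-/

set_option linter.unusedSectionVars false

noncomputable section

namespace CyclePopping

universe u v

/-! ### Self-avoiding paths and products along paths -/

section Paths

variable {V : Type u}

/-- The product of `N` over the consecutive pairs of a list. -/
def arcsProd {R : Type*} [CommMonoid R] (N : V → V → R) (l : List V) : R :=
  ((l.zip l.tail).map fun a => N a.1 a.2).prod

section ArcsProd

variable {R : Type*} [CommMonoid R] (N : V → V → R)

@[simp] lemma arcsProd_nil : arcsProd N [] = 1 := rfl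

@[simp] lemma arcsProd_singleton (a : V) : arcsProd N [a] = 1 := rfl

@[simp] lemma arcsProd_cons_cons (a b : V) (l : List V) :
    arcsProd N (a :: b :: l) = N a b * arcsProd N (b :: l) := by
  simp [arcsProd]

lemma arcsProd_append_cons (l m : List V) (a : V) :
    arcsProd N (l ++ a :: m) = arcsProd N (l ++ [a]) * arcsProd N (a :: m) := by
  induction l with
  | nil => simp
  | cons b l ih =>
    cases l with
    | nil => simp
    | cons c l =>
      simp only [List.cons_append, arcsProd_cons_cons] at ih ⊢
      rw [ih, mul_assoc]

lemma arcsProd_append_pair (l : List V) (a b : V) :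
    arcsProd N (l ++ [a] ++ [b]) = arcsProd N (l ++ [a]) * N a b := by
  rw [List.append_assoc, List.singleton_append, arcsProd_append_cons]
  simp

lemma map_arcsProd {S : Type*} [CommMonoid S] (f : R →* S) (l : List V) :
    f (arcsProd N l) = arcsProd (fun a b => f (N a b)) l := by
  unfold arcsProd
  rw [map_list_prod, List.map_map]
  rfl

lemma arcsProd_mul (N' : V → V → R) (l : List V) :
    arcsProd (fun a b => N a b * N' a b) l = arcsProd N l * arcsProd N' l := by
  unfold arcsProd
  exact List.prod_map_mul

end ArcsProd

variable [Fintype V] [DecidableEq V]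

/-- The self-avoiding lists of nodes that avoid `S`, the empty list included. -/
def paths (S : Finset V) : Finset (List V) :=
  (Finset.univ.image (fun l : {l : List V // l.Nodup} => l.1)).filter fun l => ∀ a ∈ l, a ∉ S

@[simp] lemma mem_paths {S : Finset V} {l : List V} :
    l ∈ paths S ↔ l.Nodup ∧ ∀ a ∈ l, a ∉ S := by
  simp [paths]

/-- Summation over the self-avoiding paths according to their first node. -/
lemma sum_paths {R : Type*} [AddCommMonoid R] (S : Finset V) (f : List V → R) :
    ∑ l ∈ paths S, f l = f [] + ∑ v ∈ Sᶜ, ∑ l ∈ paths (insert v S), f (v :: l) := by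
  have h : paths S = insert [] (Sᶜ.biUnion fun v => (paths (insert v S)).image (List.cons v)) := by
    ext l
    cases l with
    | nil => simp
    | cons a l =>
      simp only [mem_paths, List.nodup_cons, List.mem_cons, Finset.mem_insert, Finset.mem_biUnion,
        Finset.mem_image, Finset.mem_compl, reduceCtorEq, false_or, List.cons.injEq]
      constructor
      · rintro ⟨⟨h1, h2⟩, h3⟩
        refine ⟨a, h3 a (Or.inl rfl), l, ⟨h2, fun b hb => ?_⟩, rfl, rfl⟩
        rintro (rfl | hb')
        · exact h1 hb
        · exact h3 b (Or.inr hb) hb'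
      · rintro ⟨v, hv, l', ⟨h1, h2⟩, rfl, rfl⟩
        refine ⟨⟨fun hm => h2 _ hm (Or.inl rfl), h1⟩, ?_⟩
        rintro b (rfl | hb)
        · exact hv
        · exact fun hS => h2 b hb (Or.inr hS)
  rw [h, Finset.sum_insert (by simp), Finset.sum_biUnion]
  · congr 1
    refine Finset.sum_congr rfl fun v _ => ?_
    rw [Finset.sum_image (fun _ _ _ _ h => (List.cons.inj h).2)]
  · intro v _ w _ hvw
    rw [Function.onFun, Finset.disjoint_left]
    intro l hl hl'
    obtain ⟨_, _, rfl⟩ := Finset.mem_image.1 hl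
    obtain ⟨_, _, h⟩ := Finset.mem_image.1 hl'
    exact hvw (List.cons.inj h).1.symm

end Paths

/-! ### Expansion of a determinant along the cycles through a node -/

section CycleExpansion

variable {V : Type u} [Fintype V] [DecidableEq V] {R : Type*} [CommRing R]

/-- The matrix `M` whose rows indexed by `S` are replaced by those of the identity. Its determinant
is that of `M` with the rows and columns of `S` removed, but its index type does not depend
on `S`. -/
def pinned (M : Matrix V V R) (S : Finset V) : Matrix V V R :=
  Matrix.of fun x y => if x ∈ S then (Pi.single x 1 : V → R) y else M x y

lemma pinned_row_mem (M : Matrix V V R) {S : Finset V} {x : V} (hx : x ∈ S) :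
    pinned M S x = Pi.single x 1 := by
  ext y; simp [pinned, hx]

lemma pinned_row_notMem (M : Matrix V V R) {S : Finset V} {x : V} (hx : x ∉ S) :
    pinned M S x = M x := by
  ext y; simp [pinned, hx]

@[simp] lemma pinned_empty (M : Matrix V V R) : pinned M ∅ = M := by
  ext x y; simp [pinned]

lemma det_pinned (M : Matrix V V ℂ) (S : Finset V) :
    (pinned M S).det = (removeRowsCols M S).det := by
  rw [Matrix.twoBlockTriangular_det (pinned M S) (fun x => x ∉ S)]
  · have h1 : (pinned M S).toSquareBlockProp (fun x => x ∉ S) = removeRowsCols M S := by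
      ext x y
      simp [Matrix.toSquareBlockProp_def, pinned, removeRowsCols, x.2]
    have h2 : (pinned M S).toSquareBlockProp (fun x => ¬ x ∉ S) = 1 := by
      ext x y
      have hx := not_not.1 x.2
      simp [Matrix.toSquareBlockProp_def, pinned, hx, Matrix.one_apply, Pi.single_apply,
        Subtype.ext_iff, eq_comm]
    rw [h1, h2, Matrix.det_one, mul_one]
  · intro i hi j hj
    have hi' := not_not.1 hi
    have : j ≠ i := fun h => hj (h ▸ hi')
    simp [pinned, hi', this]

lemma det_eq_sum_updateRow (A : Matrix V V R) (z : V) :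
    A.det = ∑ v, A z v * (A.updateRow z (Pi.single v 1)).det := by
  rw [Matrix.det_eq_sum_mul_adjugate_row A z]
  simp [Matrix.adjugate_apply]

/-- The cofactor of `pinned M S` obtained when its row `u` is replaced by the basis vector of
index `z`. -/
def cofactor (M : Matrix V V R) (S : Finset V) (z u : V) : R :=
  ((pinned M S).updateRow u (Pi.single z 1)).det

lemma cofactor_self (M : Matrix V V R) (S : Finset V) (u : V) :
    cofactor M S u u = (pinned M (insert u S)).det := by
  unfold cofactor
  congr 1
  ext x y
  by_cases hx : x = u
  · subst hx; simp [pinned]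
  · simp [pinned, hx]

lemma cofactor_eq_zero (M : Matrix V V R) {S : Finset V} {z u : V} (hz : z ∈ S) (hu : u ∉ S) :
    cofactor M S z u = 0 := by
  have hne : z ≠ u := fun h => hu (h ▸ hz)
  refine Matrix.det_zero_of_row_eq hne ?_
  rw [Matrix.updateRow_ne hne, Matrix.updateRow_self, pinned_row_mem M hz]

/-- One step of a path from `z` to `u`: expand along the row `z`, then exchange the rows `z`
and `u`. -/
lemma cofactor_step (M : Matrix V V R) {S : Finset V} {z u : V} (hz : z ∉ S) (hzu : z ≠ u) :
    cofactor M S z u = -∑ v, M z v * cofactor M (insert z S) v u := by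
  unfold cofactor
  rw [det_eq_sum_updateRow _ z, ← Finset.sum_neg_distrib]
  refine Finset.sum_congr rfl fun v _ => ?_
  rw [Matrix.updateRow_ne hzu, pinned_row_notMem M hz]
  have h : ((pinned M S).updateRow u (Pi.single z 1)).updateRow z (Pi.single v 1) =
      ((pinned M (insert z S)).updateRow u (Pi.single v 1)).submatrix (Equiv.swap z u) id := by
    ext x y
    by_cases hx : x = z
    · subst hx; simp
    · by_cases hxu : x = u
      · subst hxu
        simp [hx, hzu, pinned, Matrix.updateRow_apply]
      · simp [hx, hxu, Equiv.swap_apply_of_ne_of_ne hx hxu, pinned]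
  rw [h, Matrix.det_permute, Equiv.Perm.sign_swap hzu]
  simp

variable {M : Matrix V V R} {N : V → V → R}

lemma cofactor_step_offDiag (hMN : ∀ x y, x ≠ y → M x y = -N x y) {S : Finset V} {z u : V}
    (hz : z ∉ S) (hu : u ∉ S) (hzu : z ≠ u) :
    cofactor M S z u = N z u * (pinned M (insert u (insert z S))).det +
      ∑ v ∈ (insert z (insert u S))ᶜ, N z v * cofactor M (insert z S) v u := by
  have hu' : u ∉ insert z S := by simp [hu, hzu.symm]
  rw [cofactor_step M hz hzu, ← Finset.sum_compl_add_sum (insert z (insert u S)),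
    Finset.sum_insert (by simp [hz, hzu]), Finset.sum_insert hu,
    cofactor_eq_zero M (Finset.mem_insert_self z S) hu', cofactor_self, hMN z u hzu,
    Finset.sum_eq_zero (s := S) fun v hv => by
      rw [cofactor_eq_zero M (Finset.mem_insert_of_mem hv) hu', mul_zero],
    Finset.sum_congr rfl (g := fun v => -(N z v * cofactor M (insert z S) v u)) fun v hv => by
      rw [hMN z v (fun h => by simp [h] at hv), neg_mul], Finset.sum_neg_distrib]
  ring

/-- A cofactor is a sum over the self-avoiding paths from `z` to `u`. -/
lemma cofactor_eq_sum_paths (hMN : ∀ x y, x ≠ y → M x y = -N x y) (n : ℕ) :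
    ∀ (S : Finset V) (z u : V), Sᶜ.card ≤ n → z ∉ S → u ∉ S → z ≠ u →
      cofactor M S z u = ∑ l ∈ paths (insert z (insert u S)),
        arcsProd N (z :: l ++ [u]) * (pinned M (insert u S ∪ (z :: l).toFinset)).det := by
  induction n with
  | zero =>
    intro S z u hS hz
    have : z ∈ Sᶜ := by simpa using hz
    rw [Finset.card_eq_zero.1 (Nat.le_zero.1 hS)] at this
    simp at this
  | succ n ih =>
    intro S z u hS hz hu hzu
    rw [cofactor_step_offDiag hMN hz hu hzu, sum_paths]
    congr 1
    · simp [Finset.insert_comm]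
    · refine Finset.sum_congr rfl fun v hv => ?_
      simp only [Finset.mem_compl, Finset.mem_insert, not_or] at hv
      have hcard : (insert z S)ᶜ.card ≤ n := by
        rw [Finset.compl_insert, Finset.card_erase_of_mem (by simpa using hz)]
        omega
      rw [ih (insert z S) v u hcard (by simp [hv]) (by simp [hu, hzu.symm]) hv.2.1,
        Finset.mul_sum, Finset.insert_comm u z S]
      refine Finset.sum_congr rfl fun l _ => ?_
      simp only [List.cons_append, arcsProd_cons_cons, List.toFinset_cons, mul_assoc]
      congr 4
      ext a
      simp only [Finset.mem_union, Finset.mem_insert]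
      tauto

/-- The determinant expanded along the cycles through `u`. -/
theorem det_pinned_eq_sum_cycles (hMN : ∀ x y, x ≠ y → M x y = -N x y) (hN : ∀ x, N x x = 0)
    {S : Finset V} {u : V} (hu : u ∉ S) :
    M u u * (pinned M (insert u S)).det = (pinned M S).det +
      ∑ l ∈ paths (insert u S),
        arcsProd N (u :: l ++ [u]) * (pinned M (insert u S ∪ l.toFinset)).det := by
  have key : (pinned M S).det = M u u * (pinned M (insert u S)).det -
      ∑ v ∈ (insert u S)ᶜ, N u v * cofactor M S v u := by
    rw [det_eq_sum_updateRow _ u, pinned_row_notMem M hu]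
    change ∑ v, M u v * cofactor M S v u = _
    rw [← Finset.sum_compl_add_sum (insert u S), Finset.sum_insert hu, cofactor_self,
      Finset.sum_eq_zero (s := S) fun v hv => by rw [cofactor_eq_zero M hv hu, mul_zero],
      Finset.sum_congr rfl (g := fun v => -(N u v * cofactor M S v u)) fun v hv => by
        rw [hMN u v (fun h => by simp [h] at hv), neg_mul], Finset.sum_neg_distrib]
    ring
  rw [key, sum_paths]
  have : ∀ v ∈ (insert u S)ᶜ, N u v * cofactor M S v u =
      ∑ l ∈ paths (insert v (insert u S)), arcsProd N (u :: (v :: l) ++ [u]) *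
        (pinned M (insert u S ∪ (v :: l).toFinset)).det := by
    intro v hv
    simp only [Finset.mem_compl, Finset.mem_insert, not_or] at hv
    rw [cofactor_eq_sum_paths hMN _ S v u le_rfl hv.2 hu hv.1, Finset.mul_sum]
    refine Finset.sum_congr rfl fun l _ => ?_
    simp only [List.cons_append, arcsProd_cons_cons, mul_assoc]
  rw [Finset.sum_congr rfl this]
  simp [hN]

end CycleExpansion

/-! ### Positivity of the magnetic Laplacian -/

section Positivity

variable {V : Type u} {G : SimpleGraph V}

lemma EdgeWeights.nonneg (W : EdgeWeights G) (x y : V) : 0 ≤ W.w x y := by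
  by_cases h : G.Adj x y
  · exact (W.pos x y h).le
  · exact (W.zero x y h).ge

lemma EdgeWeights.self (W : EdgeWeights G) (x : V) : W.w x x = 0 :=
  W.zero x x (G.irrefl)

lemma EdgeWeights.adj_of_ne_zero (W : EdgeWeights G) {x y : V} (h : W.w x y ≠ 0) : G.Adj x y :=
  not_not.1 fun h' => h (W.zero x y h')

/-- The coefficients `w_{xy} φ_{xy}`, that is, minus the off-diagonal part of the Laplacian. -/
def twisted (W : EdgeWeights G) (φ : Connection G) (x y : V) : ℂ :=
  (W.w x y : ℂ) * (φ.phase x y : ℂ)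

lemma twisted_self (W : EdgeWeights G) (φ : Connection G) (x : V) : twisted W φ x x = 0 := by
  simp [twisted, W.self]

lemma star_twisted (W : EdgeWeights G) (φ : Connection G) (x y : V) :
    star (twisted W φ x y) = twisted W φ y x := by
  by_cases h : G.Adj x y
  · unfold twisted
    rw [φ.inv x y h, W.symm y x, Circle.coe_inv_eq_conj]
    simp
  · simp [twisted, W.zero x y h, W.zero y x (fun h' => h h'.symm)]

lemma cycleArcs_coe (l : List V) : cycleArcs (l : Cycle V) = ((l.zip (l.rotate 1) : List (V × V))) :=
  rfl

/-- A nowhere vanishing section that is parallel along the edges makes every holonomy trivial. -/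
lemma hol_eq_one_of_parallel (φ : Connection G) (f : V → ℂ) (hf : ∀ x, f x ≠ 0)
    (hpar : ∀ x y, G.Adj x y → f x = (φ.phase x y : ℂ) * f y) (c : OrientedCycle G) :
    hol φ c = 1 := by
  obtain ⟨c, h1, h2, h3⟩ := c
  induction c using Quotient.inductionOn' with
  | h l =>
    replace h3 : ∀ a ∈ l.zip (l.rotate 1), G.Adj a.1 a.2 := h3
    have hhol : hol φ ⟨Quotient.mk'' l, h1, h2, h3⟩ =
        ((l.zip (l.rotate 1)).map fun a => φ.phase a.1 a.2).prod := rfl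
    rw [hhol]
    apply Circle.coe_injective
    have hmap : (((l.zip (l.rotate 1)).map fun a => φ.phase a.1 a.2).prod : ℂ) =
        ((l.zip (l.rotate 1)).map fun a => (φ.phase a.1 a.2 : ℂ)).prod := by
      have := map_list_prod Circle.coeHom ((l.zip (l.rotate 1)).map fun a => φ.phase a.1 a.2)
      rw [List.map_map] at this
      exact this
    rw [hmap, Circle.coe_one]
    have hprod : ((l.zip (l.rotate 1)).map fun a => f a.1).prod =
        ((l.zip (l.rotate 1)).map fun a => (φ.phase a.1 a.2 : ℂ)).prod *
          ((l.zip (l.rotate 1)).map fun a => f a.2).prod := by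
      rw [← List.prod_map_mul]
      exact congrArg List.prod (List.map_congr_left fun a ha => hpar _ _ (h3 a ha))
    have hfst : (l.zip (l.rotate 1)).map (fun a => f a.1) = l.map f := by
      rw [← Function.comp_def f Prod.fst, ← List.map_map, List.map_fst_zip (by simp)]
    have hsnd : ((l.zip (l.rotate 1)).map fun a => f a.2).prod = (l.map f).prod := by
      rw [← Function.comp_def f Prod.snd, ← List.map_map, List.map_snd_zip (by simp)]
      exact ((l.rotate_perm 1).map f).prod_eq
    rw [hfst, hsnd] at hprod
    have hne : (l.map f).prod ≠ 0 := by
      rw [Ne, List.prod_eq_zero_iff]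
      simpa using fun x _ => hf x
    exact (mul_right_cancel₀ hne (by rw [one_mul]; exact hprod)).symm

variable [Fintype V] [DecidableEq V]

lemma laplacian_offDiag (W : EdgeWeights G) (φ : Connection G) (x y : V) (h : x ≠ y) :
    laplacian W φ x y = -twisted W φ x y := by
  simp [laplacian, h, twisted]

lemma laplacian_diag (W : EdgeWeights G) (φ : Connection G) (x : V) :
    laplacian W φ x x = deg W x := by
  simp [laplacian, W.self]

lemma laplacian_apply (W : EdgeWeights G) (φ : Connection G) (x y : V) :
    laplacian W φ x y = (if x = y then (deg W x : ℂ) else 0) - twisted W φ x y := by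
  simp [laplacian, twisted, Matrix.diagonal_apply]

/-- The Laplacian as a Dirichlet form. -/
lemma laplacian_quadratic (W : EdgeWeights G) (φ : Connection G) (f : V → ℂ) :
    star f ⬝ᵥ (laplacian W φ).mulVec f =
      (((∑ x, ∑ y, W.w x y * Complex.normSq (f x - φ.phase x y * f y)) / 2 : ℝ) : ℂ) := by
  have hterm : ∀ x y, ((W.w x y * Complex.normSq (f x - φ.phase x y * f y) : ℝ) : ℂ) =
      W.w x y * (star (f x) * f x) + W.w x y * (star (f y) * f y)
        - star (f x) * twisted W φ x y * f y - star (f y) * twisted W φ y x * f x := by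
    intro x y
    rw [← star_twisted W φ x y]
    have h1 : (φ.phase x y : ℂ) * star (φ.phase x y : ℂ) = 1 := by
      have := Complex.mul_conj (φ.phase x y : ℂ)
      simp only [Circle.normSq_coe, Complex.ofReal_one] at this
      exact this
    rw [Complex.ofReal_mul, Complex.normSq_eq_conj_mul_self]
    unfold twisted
    simp only [map_sub, map_mul, star_mul', RCLike.star_def, Complex.conj_ofReal]
    simp only [RCLike.star_def] at h1
    linear_combination (W.w x y : ℂ) * (starRingEnd ℂ (f y)) * f y * h1
  have hdeg : ∑ x, ∑ y, (W.w x y : ℂ) * (star (f x) * f x) =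
      ∑ x, (deg W x : ℂ) * (star (f x) * f x) := by
    refine Finset.sum_congr rfl fun x _ => ?_
    rw [← Finset.sum_mul, deg, Complex.ofReal_sum]
  have hdeg' : ∑ x, ∑ y, (W.w x y : ℂ) * (star (f y) * f y) =
      ∑ x, (deg W x : ℂ) * (star (f x) * f x) := by
    rw [Finset.sum_comm, ← hdeg]
    refine Finset.sum_congr rfl fun x _ => Finset.sum_congr rfl fun y _ => by rw [W.symm x y]
  have hswap : ∑ x, ∑ y, star (f y) * twisted W φ y x * f x =
      ∑ x, ∑ y, star (f x) * twisted W φ x y * f y := Finset.sum_comm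
  have hleft : star f ⬝ᵥ (laplacian W φ).mulVec f = ∑ x, (deg W x : ℂ) * (star (f x) * f x) -
      ∑ x, ∑ y, star (f x) * twisted W φ x y * f y := by
    simp only [dotProduct, Matrix.mulVec, laplacian_apply, sub_mul, Finset.sum_sub_distrib, ite_mul,
      zero_mul, Finset.sum_ite_eq, Finset.mem_univ, if_true, mul_sub, Finset.mul_sum, Pi.star_apply]
    congr 1
    · exact Finset.sum_congr rfl fun x _ => by ring
    · exact Finset.sum_congr rfl fun x _ => Finset.sum_congr rfl fun y _ => by ring
  have hsum : (((∑ x, ∑ y, W.w x y * Complex.normSq (f x - φ.phase x y * f y)) : ℝ) : ℂ) =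
      2 * (star f ⬝ᵥ (laplacian W φ).mulVec f) := by
    simp only [Complex.ofReal_sum, hterm, Finset.sum_sub_distrib, Finset.sum_add_distrib]
    rw [hdeg, hdeg', hswap, hleft]
    ring
  rw [Complex.ofReal_div, hsum]
  simp

lemma laplacian_isHermitian (W : EdgeWeights G) (φ : Connection G) :
    (laplacian W φ).IsHermitian := by
  refine Matrix.IsHermitian.ext fun x y => ?_
  by_cases h : x = y
  · subst h; simp [laplacian_diag]
  · rw [laplacian_offDiag _ _ _ _ h, laplacian_offDiag _ _ _ _ (Ne.symm h), star_neg, star_twisted]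

open ComplexOrder in
/-- A vector in the kernel is parallel, hence nowhere zero by connectedness, and the existence of
a nontrivial holonomy excludes it. -/
lemma laplacian_posDef (hG : G.Connected) (W : EdgeWeights G) (φ : Connection G)
    (hφ : Nontrivial φ) : (laplacian W φ).PosDef := by
  rw [Matrix.posDef_iff_dotProduct_mulVec]
  refine ⟨laplacian_isHermitian W φ, fun {f} hf => ?_⟩
  rw [laplacian_quadratic]
  have hnn : ∀ x y, 0 ≤ W.w x y * Complex.normSq (f x - φ.phase x y * f y) := fun x y =>
    mul_nonneg (W.nonneg x y) (Complex.normSq_nonneg _)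
  have hpos : 0 < ∑ x, ∑ y, W.w x y * Complex.normSq (f x - φ.phase x y * f y) := by
    refine lt_of_le_of_ne (Finset.sum_nonneg fun x _ => Finset.sum_nonneg fun y _ => hnn x y)
      fun h0 => ?_
    have hpar : ∀ x y, G.Adj x y → f x = (φ.phase x y : ℂ) * f y := by
      intro x y hxy
      have h1 := (Finset.sum_eq_zero_iff_of_nonneg
        (fun x _ => Finset.sum_nonneg fun y _ => hnn x y)).1 h0.symm x (Finset.mem_univ x)
      have h2 := (Finset.sum_eq_zero_iff_of_nonneg (fun y _ => hnn x y)).1 h1 y (Finset.mem_univ y)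
      rcases mul_eq_zero.1 h2 with h | h
      · exact absurd h (W.pos x y hxy).ne'
      · exact sub_eq_zero.1 (Complex.normSq_eq_zero.1 h)
    obtain ⟨x₀, hx₀⟩ := Function.ne_iff.1 hf
    have hne : ∀ x, f x ≠ 0 := by
      intro x
      obtain ⟨p⟩ := hG.preconnected x x₀
      induction p with
      | nil => exact hx₀
      | cons h p ih =>
        rw [hpar _ _ h]
        exact mul_ne_zero (Circle.coe_ne_zero _) (ih hx₀)
    obtain ⟨c, hc⟩ := hφ
    exact hc (hol_eq_one_of_parallel φ f hne hpar c)
  exact_mod_cast half_pos hpos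

/-- The determinant of the Laplacian with the rows and columns of `S` removed, as a real number. -/
def removedDet (W : EdgeWeights G) (φ : Connection G) (S : Finset V) : ℝ :=
  (removeRowsCols (laplacian W φ) S).det.re

section Determinants

variable (hG : G.Connected) (W : EdgeWeights G) (φ : Connection G) (hφ : Nontrivial φ)

include hG hφ in
open ComplexOrder in
lemma removeRowsCols_det_pos (S : Finset V) : 0 < (removeRowsCols (laplacian W φ) S).det :=
  ((laplacian_posDef hG W φ hφ).submatrix Subtype.val_injective).det_pos

include hG hφ in
lemma removedDet_pos (S : Finset V) : 0 < removedDet W φ S :=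
  (Complex.pos_iff.1 (removeRowsCols_det_pos hG W φ hφ S)).1

include hG hφ in
lemma coe_removedDet (S : Finset V) :
    (removedDet W φ S : ℂ) = (removeRowsCols (laplacian W φ) S).det :=
  Complex.ext (by simp [removedDet])
    (by simpa using (Complex.pos_iff.1 (removeRowsCols_det_pos hG W φ hφ S)).2)

lemma det_removeRowsCols_empty :
    (removeRowsCols (laplacian W φ) ∅).det = (laplacian W φ).det := by
  rw [← det_pinned, pinned_empty]

include hG hφ in
lemma coe_removedDet_empty : (removedDet W φ ∅ : ℂ) = (laplacian W φ).det := by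
  rw [coe_removedDet hG W φ hφ, det_removeRowsCols_empty]

lemma removedDet_univ : removedDet W φ Finset.univ = 1 := by
  have : IsEmpty {x // x ∉ (Finset.univ : Finset V)} := ⟨fun x => x.2 (Finset.mem_univ _)⟩
  simp [removedDet, Matrix.det_isEmpty]

include hG hφ in
/-- The real part of the expansion of the determinant along the cycles through `y`: since the
minors are real, the holonomies are replaced by their real parts `cos θ`. -/
lemma deg_mul_removedDet {S : Finset V} {y : V} (hy : y ∉ S) :
    deg W y * removedDet W φ (insert y S) = removedDet W φ S +
      ∑ l ∈ paths (insert y S), arcsProd W.w (y :: l ++ [y]) *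
        (arcsProd (fun a b => (φ.phase a b : ℂ)) (y :: l ++ [y])).re *
        removedDet W φ (insert y S ∪ l.toFinset) := by
  have h := det_pinned_eq_sum_cycles (laplacian_offDiag W φ) (twisted_self W φ) hy
  simp only [det_pinned, ← coe_removedDet hG W φ hφ, laplacian_diag] at h
  have h' := congrArg Complex.re h
  rw [← Complex.ofReal_mul, Complex.ofReal_re, Complex.add_re, Complex.ofReal_re,
    Complex.re_sum] at h'
  rw [h']
  congr 1
  refine Finset.sum_congr rfl fun l _ => ?_
  have hw : arcsProd (twisted W φ) (y :: l ++ [y]) =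
      ((arcsProd W.w (y :: l ++ [y]) : ℝ) : ℂ) *
      arcsProd (fun a b => (φ.phase a b : ℂ)) (y :: l ++ [y]) := by
    have := map_arcsProd W.w Complex.ofRealHom.toMonoidHom (y :: l ++ [y])
    simp only [RingHom.toMonoidHom_eq_coe, MonoidHom.coe_coe, Complex.ofRealHom_eq_coe] at this
    rw [this, ← arcsProd_mul]
    rfl
  rw [hw, Complex.re_mul_ofReal, Complex.re_ofReal_mul]

end Determinants

end Positivity

/-! ### Fixed points of a nonnegative linear recursion -/

/-- If `U` is a nonnegative solution of `U = u₀ + U Q` whose support is reached by the iterates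
`u_{n+1} = u_n Q`, then `∑ u_n = U`. The partial sums are at most `U`; conversely `U` is bounded by
a multiple of a partial sum, so that the remainders `U Q ^ N` tend to zero. -/
lemma hasSum_of_fixedPoint {α : Type*} (s : Finset α) (Q : α → α → ℝ) (hQ : ∀ a b, 0 ≤ Q a b)
    (u : ℕ → α → ℝ) (hu : ∀ n a, 0 ≤ u n a)
    (hrec : ∀ n, ∀ a ∈ s, u (n + 1) a = ∑ b ∈ s, u n b * Q b a)
    (U : α → ℝ) (hU0 : ∀ a, 0 ≤ U a) (hU : ∀ a ∈ s, U a = u 0 a + ∑ b ∈ s, U b * Q b a)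
    (hsupp : ∀ a ∈ s, U a ≠ 0 → ∃ k, u k a ≠ 0) :
    ∀ a ∈ s, HasSum (fun n => u n a) (U a) := by
  have hsucc : ∀ N, ∀ a ∈ s, ∑ n ∈ Finset.range (N + 1), u n a =
      u 0 a + ∑ b ∈ s, (∑ n ∈ Finset.range N, u n b) * Q b a := by
    intro N a ha
    rw [Finset.sum_range_succ', add_comm]
    congr 1
    rw [Finset.sum_congr rfl fun n _ => hrec n a ha, Finset.sum_comm]
    exact Finset.sum_congr rfl fun b _ => (Finset.sum_mul _ _ _).symm
  have hle : ∀ N, ∀ a ∈ s, ∑ n ∈ Finset.range N, u n a ≤ U a := by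
    intro N
    induction N with
    | zero => intro a _; simpa using hU0 a
    | succ N ih =>
      intro a ha
      rw [hsucc N a ha, hU a ha]
      gcongr with b hb
      · exact hQ b a
      · exact ih b hb
  have hsummable : ∀ a ∈ s, Summable fun n => u n a := fun a ha =>
    summable_of_sum_range_le (fun n => hu n a) (fun N => hle N a ha)
  choose! k hk using hsupp
  set K := s.sup k + 1
  -- every index in the support of `U` is reached before time `K`
  have hdom : ∃ C : ℝ, ∀ a ∈ s, U a ≤ C * ∑ j ∈ Finset.range K, u j a := by
    refine ⟨∑ a ∈ s, U a / ∑ j ∈ Finset.range K, u j a, fun a ha => ?_⟩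
    by_cases h0 : U a = 0
    · rw [h0]
      exact mul_nonneg (Finset.sum_nonneg fun a _ =>
        div_nonneg (hU0 a) (Finset.sum_nonneg fun j _ => hu j a))
        (Finset.sum_nonneg fun j _ => hu j a)
    · have hpos : 0 < ∑ j ∈ Finset.range K, u j a :=
        Finset.sum_pos' (fun j _ => hu j a) ⟨k a, Finset.mem_range.2
          (Nat.lt_succ_of_le (Finset.le_sup ha)), lt_of_le_of_ne (hu _ _) (hk a ha h0).symm⟩
      rw [← div_le_iff₀ hpos]
      exact Finset.single_le_sum (f := fun a => U a / ∑ j ∈ Finset.range K, u j a)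
        (fun a _ => div_nonneg (hU0 a) (Finset.sum_nonneg fun j _ => hu j a)) ha
  obtain ⟨C, hC⟩ := hdom
  -- the remainder is `U Q ^ N`, and `Q ^ N` maps the partial sum to a block of later terms
  have hrem : ∀ N, ∀ a ∈ s, U a - ∑ n ∈ Finset.range N, u n a ≤
      C * ∑ j ∈ Finset.range K, u (j + N) a := by
    intro N
    induction N with
    | zero => intro a ha; simpa using hC a ha
    | succ N ih =>
      intro a ha
      rw [hsucc N a ha, hU a ha, add_sub_add_left_eq_sub, ← Finset.sum_sub_distrib]
      calc ∑ b ∈ s, (U b * Q b a - (∑ n ∈ Finset.range N, u n b) * Q b a)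
          = ∑ b ∈ s, (U b - ∑ n ∈ Finset.range N, u n b) * Q b a :=
            Finset.sum_congr rfl fun b _ => (sub_mul _ _ _).symm
        _ ≤ ∑ b ∈ s, (C * ∑ j ∈ Finset.range K, u (j + N) b) * Q b a :=
            Finset.sum_le_sum fun b hb => mul_le_mul_of_nonneg_right (ih b hb) (hQ b a)
        _ = C * ∑ j ∈ Finset.range K, u (j + (N + 1)) a := by
            simp only [← add_assoc, hrec _ a ha]
            rw [Finset.sum_comm, Finset.mul_sum]
            refine Finset.sum_congr rfl fun b _ => ?_
            rw [← Finset.sum_mul, mul_assoc]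
  intro a ha
  refine (hsummable a ha).hasSum_iff_tendsto_nat.2 ?_
  have htail : Filter.Tendsto (fun N => C * ∑ j ∈ Finset.range K, u (j + N) a) Filter.atTop
      (nhds 0) := by
    have : Filter.Tendsto (fun N => C * ∑ j ∈ Finset.range K, u (j + N) a) Filter.atTop
        (nhds (C * ∑ j ∈ Finset.range K, 0)) := by
      refine (tendsto_finsetSum _ fun j _ => ?_).const_mul C
      have := (Filter.tendsto_add_atTop_iff_nat j).2 (hsummable a ha).tendsto_atTop_zero
      simpa only [add_comm j] using this
    simpa using this
  have hsq := squeeze_zero (fun N => sub_nonneg.2 (hle N a ha)) (fun N => hrem N a ha) htail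
  simpa using hsq.const_sub (U a)

/-! ### The cycle closed by a step of a loop-erased walk -/

section Formed

variable {V : Type u} [DecidableEq V] {G : SimpleGraph V}

lemma takeWhile_of_notMem {l : List V} {z : V} (h : z ∉ l) :
    l.takeWhile (fun a => decide (a ≠ z)) = l := by
  rw [List.takeWhile_eq_self_iff]
  intro a ha
  simpa using fun h' : a = z => h (h' ▸ ha)

lemma dropWhile_of_notMem {l : List V} {z : V} (h : z ∉ l) :
    l.dropWhile (fun a => decide (a ≠ z)) = [] := by
  rw [List.dropWhile_eq_nil_iff]
  intro a ha
  simpa using fun h' : a = z => h (h' ▸ ha)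

lemma takeWhile_append_cons {l m : List V} {z : V} (h : z ∉ l) :
    (l ++ z :: m).takeWhile (fun a => decide (a ≠ z)) = l := by
  rw [List.takeWhile_append_of_pos (by rintro a ha; simpa using fun h' : a = z => h (h' ▸ ha))]
  simp

lemma dropWhile_append_cons {l m : List V} {z : V} (h : z ∉ l) :
    (l ++ z :: m).dropWhile (fun a => decide (a ≠ z)) = z :: m := by
  rw [List.dropWhile_append_of_pos (by rintro a ha; simpa using fun h' : a = z => h (h' ▸ ha))]
  simp

lemma notMem_takeWhile (l : List V) (z : V) : z ∉ l.takeWhile (fun a => decide (a ≠ z)) := by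
  intro h
  simpa using List.mem_takeWhile_imp h

lemma eq_takeWhile_append (l : List V) (z : V) (hz : z ∈ l) :
    ∃ m, l = l.takeWhile (fun a => decide (a ≠ z)) ++ z :: m ∧
      l.dropWhile (fun a => decide (a ≠ z)) = z :: m := by
  obtain ⟨l₁, m, rfl, h⟩ := List.eq_append_cons_of_mem hz
  exact ⟨m, by rw [takeWhile_append_cons h], dropWhile_append_cons h⟩

lemma closed_zip (y : V) (m : List V) :
    (y :: m ++ [y]).zip (y :: m ++ [y]).tail = (y :: m).zip ((y :: m).rotate 1) := by
  have h : (y :: m).rotate 1 = m ++ [y] := by simp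
  have h1 : (y :: m ++ [y]).tail = (m ++ [y]) ++ [] := by simp
  rw [h, h1, List.zip_append (by simp)]
  simp

lemma cos_theta (φ : Connection G) (c : OrientedCycle G) :
    Real.cos (theta φ c) = (hol φ c : ℂ).re := by
  rw [theta, Real.cos_neg, Complex.cos_arg (Circle.coe_ne_zero _),
    show ‖(hol φ c : ℂ)‖ = 1 from Circle.norm_coe _, div_one]

lemma alpha_nonneg (φ : Connection G) (c : OrientedCycle G) : 0 ≤ alpha φ c :=
  sub_nonneg.2 (Real.cos_le_one _)

lemma hol_eq_arcsProd (φ : Connection G) (c : OrientedCycle G) {y : V} {m : List V}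
    (hc : c.1 = (y :: m : List V)) : hol φ c = arcsProd φ.phase (y :: m ++ [y]) := by
  unfold hol OrientedCycle.arcs arcsProd
  rw [hc, cycleArcs_coe, closed_zip, Multiset.map_coe, Multiset.prod_coe]

/-- The real part of the holonomy of a cycle described by a list. -/
lemma one_sub_alpha (φ : Connection G) (c : OrientedCycle G) {y : V} {m : List V}
    (hc : c.1 = (y :: m : List V)) :
    1 - alpha φ c = (arcsProd (fun a b => (φ.phase a b : ℂ)) (y :: m ++ [y])).re := by
  rw [alpha, sub_sub_cancel, cos_theta, hol_eq_arcsProd φ c hc]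
  have := map_arcsProd φ.phase Circle.coeHom (y :: m ++ [y])
  exact congrArg Complex.re this

lemma adj_of_arcsProd_ne_zero (W : EdgeWeights G) {l : List V} (h : arcsProd W.w l ≠ 0) :
    ∀ a ∈ l.zip l.tail, G.Adj a.1 a.2 := by
  intro a ha
  refine W.adj_of_ne_zero fun h0 => h ?_
  unfold arcsProd
  rw [List.prod_eq_zero_iff]
  exact List.mem_map.2 ⟨a, ha, h0⟩

lemma arcsProd_nonneg (W : EdgeWeights G) (l : List V) : 0 ≤ arcsProd W.w l := by
  unfold arcsProd
  refine List.prod_nonneg fun b hb => ?_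
  obtain ⟨a, ha, rfl⟩ := List.mem_map.1 hb
  exact W.nonneg _ _

/-- A self-avoiding list whose closure runs along edges is an oriented cycle. -/
lemma exists_orientedCycle {y : V} {m : List V} (hnd : (y :: m).Nodup)
    (hadj : ∀ a ∈ (y :: m ++ [y]).zip (y :: m ++ [y]).tail, G.Adj a.1 a.2) :
    ∃ c : OrientedCycle G, c.1 = (y :: m : List V) := by
  refine ⟨⟨(y :: m : List V), hnd, ?_, ?_⟩, rfl⟩
  · cases m with
    | nil => exact absurd (hadj (y, y) (by simp)) (G.irrefl)
    | cons a m => simp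
  · intro a ha
    rw [cycleArcs_coe, ← closed_zip] at ha
    exact hadj a ha

variable [Fintype V]

open Classical in
/-- The oriented cycles (at most one) formed when a walk with loop-erased path `l` steps to `z`. -/
def formed (G : SimpleGraph V) (l : List V) (z : V) : Finset (OrientedCycle G) :=
  Finset.univ.filter fun c => c.1 = (l.dropWhile (fun a => decide (a ≠ z)) : Cycle V)

lemma mem_formed {l : List V} {z : V} {c : OrientedCycle G} :
    c ∈ formed G l z ↔ c.1 = (l.dropWhile (fun a => decide (a ≠ z)) : Cycle V) := by
  simp [formed]

lemma formed_eq_empty {l : List V} {z : V} (h : z ∉ l) : formed G l z = ∅ := by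
  rw [Finset.eq_empty_iff_forall_notMem]
  intro c hc
  rw [mem_formed, dropWhile_of_notMem h] at hc
  have := c.2.2.1
  rw [hc] at this
  simp at this

lemma formed_eq_singleton {l : List V} {z : V} {c : OrientedCycle G} (hc : c ∈ formed G l z) :
    formed G l z = {c} := by
  ext c'
  rw [Finset.mem_singleton]
  constructor
  · intro h
    rw [mem_formed] at h hc
    exact Subtype.ext (h.trans hc.symm)
  · rintro rfl; exact hc

/-- The probability that the cycle possibly formed by the step to `z` is rejected. -/
def rejectProb (φ : Connection G) (l : List V) (z : V) : ℝ :=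
  ∏ c ∈ formed G l z, (1 - alpha φ c)

lemma rejectProb_nonneg (φ : Connection G) (hweak : WeaklyInconsistent φ) (l : List V) (z : V) :
    0 ≤ rejectProb φ l z :=
  Finset.prod_nonneg fun c _ => by
    rw [alpha, sub_sub_cancel]; exact hweak c

lemma rejectProb_of_notMem (φ : Connection G) {l : List V} {z : V} (h : z ∉ l) :
    rejectProb φ l z = 1 := by
  rw [rejectProb, formed_eq_empty h, Finset.prod_empty]

/-- The cycle `y :: m` is rejected with probability `cos θ`, the real part of its holonomy. When
`y :: m` does not close along edges of the graph, its weight is zero. -/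
lemma arcsProd_mul_rejectProb (W : EdgeWeights G) (φ : Connection G) {l m : List V} {y : V}
    (hnd : (l ++ y :: m).Nodup) :
    arcsProd W.w (y :: m ++ [y]) * rejectProb φ (l ++ y :: m) y =
      arcsProd W.w (y :: m ++ [y]) *
        (arcsProd (fun a b => (φ.phase a b : ℂ)) (y :: m ++ [y])).re := by
  by_cases h0 : arcsProd W.w (y :: m ++ [y]) = 0
  · simp only [h0, zero_mul]
  · have hyl : y ∉ l := fun h => (List.nodup_append.1 hnd).2.2 y h y (by simp) rfl
    obtain ⟨c, hc⟩ := exists_orientedCycle (List.nodup_append.1 hnd).2.1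
      (adj_of_arcsProd_ne_zero W h0)
    have hmem : c ∈ formed G (l ++ y :: m) y := by
      rw [mem_formed, dropWhile_append_cons hyl, hc]
    rw [rejectProb, formed_eq_singleton hmem, Finset.prod_singleton, one_sub_alpha φ c hc]

/-! ### Expected number of visits of the loop-erased walk -/

/-- The transition probability from the last node of a path; zero for the empty path. -/
def lastStep (W : EdgeWeights G) (l : List V) (z : V) : ℝ :=
  (l.getLast?).elim 0 fun y => transProb W y z

/-- The degree of the last node of a path; zero for the empty path. -/
def lastDeg (W : EdgeWeights G) (l : List V) : ℝ :=
  (l.getLast?).elim 0 fun y => deg W y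

@[simp] lemma lastStep_append (W : EdgeWeights G) (l : List V) (y z : V) :
    lastStep W (l ++ [y]) z = transProb W y z := by
  simp [lastStep]

@[simp] lemma lastStep_nil (W : EdgeWeights G) (z : V) : lastStep W [] z = 0 := rfl

@[simp] lemma lastDeg_append (W : EdgeWeights G) (l : List V) (y : V) :
    lastDeg W (l ++ [y]) = deg W y := by
  simp [lastDeg]

lemma deg_nonneg (W : EdgeWeights G) (x : V) : 0 ≤ deg W x :=
  Finset.sum_nonneg fun y _ => W.nonneg x y

lemma transProb_nonneg (W : EdgeWeights G) (x y : V) : 0 ≤ transProb W x y :=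
  div_nonneg (W.nonneg x y) (deg_nonneg W x)

lemma deg_mul_transProb (W : EdgeWeights G) (x y : V) : deg W x * transProb W x y = W.w x y := by
  unfold transProb
  by_cases h : deg W x = 0
  · have h' := (Finset.sum_eq_zero_iff_of_nonneg (fun y _ => W.nonneg x y)).1 h y
      (Finset.mem_univ y)
    simp [h, h']
  · rw [mul_div_cancel₀ _ h]

lemma lastStep_nonneg (W : EdgeWeights G) (l : List V) (z : V) : 0 ≤ lastStep W l z := by
  unfold lastStep
  cases l.getLast? with
  | none => exact le_rfl
  | some y => exact transProb_nonneg W y z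

lemma lastDeg_nonneg (W : EdgeWeights G) (l : List V) : 0 ≤ lastDeg W l := by
  unfold lastDeg
  cases l.getLast? with
  | none => exact le_rfl
  | some y => exact deg_nonneg W y

lemma arcsProd_lastDeg_lastStep (W : EdgeWeights G) {l : List V} (hl : l ≠ []) (z : V) :
    arcsProd W.w l * lastDeg W l * lastStep W l z = arcsProd W.w (l ++ [z]) := by
  obtain ⟨l', y, rfl⟩ : ∃ l' y, l = l' ++ [y] := ⟨_, _, (List.dropLast_append_getLast hl).symm⟩
  rw [lastDeg_append, lastStep_append, arcsProd_append_pair, mul_assoc, deg_mul_transProb]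

/-- The expected number of times that the loop-erased path of a walk, started at `x` and stopped in
`A` or upon acceptance of a cycle, equals `l`. -/
def visits (W : EdgeWeights G) (φ : Connection G) (A : Finset V) (x : V) (l : List V) : ℝ :=
  if l.head? = some x then
    arcsProd W.w l * lastDeg W l * removedDet W φ (A ∪ l.toFinset) / removedDet W φ A
  else 0

/-- The transition probabilities of the loop-erased path, until the walk is stopped. -/
def pathKernel (W : EdgeWeights G) (φ : Connection G) (A : Finset V) (l l' : List V) : ℝ :=
  ∑ z, if z ∉ A ∧ l.takeWhile (fun a => decide (a ≠ z)) ++ [z] = l' then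
    lastStep W l z * rejectProb φ l z else 0

lemma pathKernel_nonneg (W : EdgeWeights G) (φ : Connection G) (hweak : WeaklyInconsistent φ)
    (A : Finset V) (l l' : List V) : 0 ≤ pathKernel W φ A l l' := by
  refine Finset.sum_nonneg fun z _ => ?_
  split_ifs
  · exact mul_nonneg (lastStep_nonneg W l z) (rejectProb_nonneg φ hweak l z)
  · exact le_rfl

lemma pathKernel_append (W : EdgeWeights G) (φ : Connection G) {A : Finset V} (l l' : List V)
    {y : V} (hy : y ∉ A) :
    pathKernel W φ A l (l' ++ [y]) =
      if l.takeWhile (fun a => decide (a ≠ y)) = l' then lastStep W l y * rejectProb φ l y else 0 := by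
  unfold pathKernel
  rw [Finset.sum_eq_single y]
  · simp [hy]
  · intro z _ hz
    rw [if_neg]
    rintro ⟨_, h⟩
    exact hz (by simpa using (List.append_inj' h rfl).2)
  · simp

/-- The paths that a step to `y` turns into `l ++ [y]`: the step appends `y` to `l`, or it closes a
cycle `y :: m` that is erased. -/
lemma paths_filter_takeWhile {A : Finset V} {l : List V} {y : V} (h : l ++ [y] ∈ paths A) :
    (paths A).filter (fun l' => l'.takeWhile (fun a => decide (a ≠ y)) = l) =
      insert l ((paths (insert y (A ∪ l.toFinset))).image fun m => l ++ y :: m) := by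
  rw [mem_paths, List.nodup_append] at h
  obtain ⟨⟨hl, _, hly⟩, hA⟩ := h
  have hyl : y ∉ l := fun h' => hly y h' y (by simp) rfl
  ext l'
  rw [Finset.mem_filter, Finset.mem_insert, Finset.mem_image]
  constructor
  · rintro ⟨h1, h2⟩
    by_cases hy : y ∈ l'
    · right
      obtain ⟨m, hm, _⟩ := eq_takeWhile_append l' y hy
      rw [h2] at hm
      refine ⟨m, ?_, hm.symm⟩
      rw [hm, mem_paths, List.nodup_append, List.nodup_cons] at h1
      rw [mem_paths]
      refine ⟨h1.1.2.1.2, fun a ha => ?_⟩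
      simp only [Finset.mem_insert, Finset.mem_union, List.mem_toFinset, not_or]
      exact ⟨fun h => h1.1.2.1.1 (h ▸ ha), h1.2 a (by simp [ha]),
        fun hal => h1.1.2.2 a hal a (by simp [ha]) rfl⟩
    · left
      rw [← h2, takeWhile_of_notMem hy]
  · rintro (rfl | ⟨m, hm, rfl⟩)
    · exact ⟨mem_paths.2 ⟨hl, fun a ha => hA a (by simp [ha])⟩, takeWhile_of_notMem hyl⟩
    · refine ⟨?_, takeWhile_append_cons hyl⟩
      rw [mem_paths] at hm ⊢
      have hm2 : ∀ a ∈ m, a ≠ y ∧ a ∉ A ∧ a ∉ l := fun a ha => by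
        simpa [not_or] using hm.2 a ha
      refine ⟨List.nodup_append.2 ⟨hl, List.nodup_cons.2 ⟨fun h => (hm2 y h).1 rfl, hm.1⟩, ?_⟩, ?_⟩
      · intro a ha b hb hab
        subst hab
        rcases List.mem_cons.1 hb with rfl | hb
        · exact hyl ha
        · exact (hm2 a hb).2.2 ha
      · intro a ha
        rcases List.mem_append.1 ha with ha | ha
        · exact hA a (by simp [ha])
        · rcases List.mem_cons.1 ha with rfl | ha
          · exact hA a (by simp)
          · exact (hm2 a ha).2.1

lemma sum_mul_pathKernel (W : EdgeWeights G) (φ : Connection G) {A : Finset V} (g : List V → ℝ)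
    {l : List V} {y : V} (h : l ++ [y] ∈ paths A) :
    ∑ l' ∈ paths A, g l' * pathKernel W φ A l' (l ++ [y]) =
      g l * (lastStep W l y) + ∑ m ∈ paths (insert y (A ∪ l.toFinset)),
        g (l ++ y :: m) * (lastStep W (l ++ y :: m) y * rejectProb φ (l ++ y :: m) y) := by
  have hyA : y ∉ A := (mem_paths.1 h).2 y (by simp)
  have hyl : y ∉ l := fun h' =>
    (List.nodup_append.1 (mem_paths.1 h).1).2.2 y h' y (by simp) rfl
  simp only [pathKernel_append W φ _ _ hyA, mul_ite, mul_zero]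
  rw [← Finset.sum_filter, paths_filter_takeWhile h, Finset.sum_insert, Finset.sum_image,
    rejectProb_of_notMem φ hyl, mul_one]
  · intro m _ m' _ h
    simpa using h
  · simp

variable (hG : G.Connected) (W : EdgeWeights G) (φ : Connection G) (hφ : Nontrivial φ)

include hG hφ in
lemma visits_nonneg (A : Finset V) (x : V) (l : List V) : 0 ≤ visits W φ A x l := by
  unfold visits
  split_ifs
  · exact div_nonneg (mul_nonneg (mul_nonneg (arcsProd_nonneg W l) (lastDeg_nonneg W l))
      (removedDet_pos hG W φ hφ _).le) (removedDet_pos hG W φ hφ _).le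
  · exact le_rfl

lemma visits_mul_lastStep (A : Finset V) {x : V} {l : List V} (hl : l.head? = some x) (z : V) :
    visits W φ A x l * lastStep W l z =
      arcsProd W.w (l ++ [z]) * removedDet W φ (A ∪ l.toFinset) / removedDet W φ A := by
  have hne : l ≠ [] := by rintro rfl; simp at hl
  rw [visits, if_pos hl, ← arcsProd_lastDeg_lastStep W hne z]
  ring

include hG hφ in
/-- The expected numbers of visits solve the linear equation of the loop-erased path; this is the
expansion of the determinant along the cycles through the last node of the path. -/
lemma visits_fixedPoint (A : Finset V) {x : V} (l : List V) (hl : l ∈ paths A) :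
    visits W φ A x l = (if l = [x] then 1 else 0) +
      ∑ l' ∈ paths A, visits W φ A x l' * pathKernel W φ A l' l := by
  rcases List.eq_nil_or_concat l with rfl | ⟨l, y, rfl⟩
  · simp [visits, pathKernel]
  rw [List.concat_eq_append] at hl ⊢
  rw [sum_mul_pathKernel W φ _ hl]
  have hdA := (removedDet_pos hG W φ hφ A).ne'
  by_cases hx : (l ++ [y]).head? = some x
  · have hy : y ∉ A ∪ l.toFinset := by
      rw [Finset.mem_union, List.mem_toFinset, not_or]
      exact ⟨(mem_paths.1 hl).2 y (by simp), fun h' =>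
        (List.nodup_append.1 (mem_paths.1 hl).1).2.2 y h' y (by simp) rfl⟩
    -- the initial term if the path is `[x]`, and otherwise the step that appends `y`
    have hfirst : (if l ++ [y] = [x] then 1 else 0) + visits W φ A x l * lastStep W l y =
        arcsProd W.w (l ++ [y]) * removedDet W φ (A ∪ l.toFinset) / removedDet W φ A := by
      cases l with
      | nil =>
        have : y = x := by simpa using hx
        simp [this, hdA]
      | cons a l =>
        rw [visits_mul_lastStep W φ A (by simpa using hx), if_neg (by simp), zero_add]
    rw [← add_assoc, hfirst]
    have hset : A ∪ (l ++ [y]).toFinset = insert y (A ∪ l.toFinset) := by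
      rw [List.toFinset_append, List.toFinset_cons, List.toFinset_nil, Finset.union_insert,
        Finset.union_insert, Finset.union_empty]
    rw [visits, if_pos hx, lastDeg_append, hset, mul_assoc, deg_mul_removedDet hG W φ hφ hy,
      mul_add, add_div]
    congr 1
    rw [Finset.mul_sum, Finset.sum_div]
    refine Finset.sum_congr rfl fun m hm => ?_
    have hhead : (l ++ y :: m).head? = some x := by
      cases l <;> simpa using hx
    have hmem : l ++ y :: m ∈ paths A := by
      have : l ++ y :: m ∈ (paths A).filter
          (fun l' => l'.takeWhile (fun a => decide (a ≠ y)) = l) := by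
        rw [paths_filter_takeWhile hl]
        exact Finset.mem_insert_of_mem (Finset.mem_image_of_mem _ hm)
      exact (Finset.mem_filter.1 this).1
    have hset' : A ∪ (l ++ y :: m).toFinset = insert y (A ∪ l.toFinset) ∪ m.toFinset := by
      rw [List.toFinset_append, List.toFinset_cons, Finset.union_insert, Finset.union_insert,
        Finset.insert_union, Finset.union_assoc]
    have hv := visits_mul_lastStep W φ A hhead y
    have hr := arcsProd_mul_rejectProb W φ (mem_paths.1 hmem).1
    rw [hset', List.append_assoc, List.cons_append, arcsProd_append_cons, ← List.cons_append] at hv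
    linear_combination (-rejectProb φ (l ++ y :: m) y) * hv - (arcsProd W.w (l ++ [y]) *
      removedDet W φ (insert y (A ∪ l.toFinset) ∪ m.toFinset) / removedDet W φ A) * hr
  · have h1 : ¬ (l ++ [y] = [x]) := by
      intro h; rw [h] at hx; simp at hx
    have h3 : ∀ m, visits W φ A x (l ++ y :: m) = 0 := by
      intro m
      rw [visits, if_neg]
      intro h; apply hx
      cases l <;> simpa using h
    have h2 : visits W φ A x l * lastStep W l y = 0 := by
      cases l with
      | nil => simp
      | cons a l =>
        rw [visits, if_neg, zero_mul]
        intro h; apply hx; simpa using h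
    simp only [h3, h2, if_neg h1, zero_mul, Finset.sum_const_zero, add_zero]

end Formed

/-! ### Loop-erased paths before the stopping time -/

section Alive

variable {V : Type u} [DecidableEq V] {G : SimpleGraph V}

/-- Up to time `n`, the walk has neither hit `A` nor closed an accepted cycle. -/
def Alive (A : Finset V) (X : ℕ → V) (b : OrientedCycle G → ℕ → Bool) (n : ℕ) : Prop :=
  ∀ m ≤ n, X m ∉ A ∧ ∀ c : OrientedCycle G, FormsCycle X c m → b c m = false

lemma Alive.mono {A : Finset V} {X : ℕ → V} {b : OrientedCycle G → ℕ → Bool} {m n : ℕ}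
    (h : Alive A X b n) (hmn : m ≤ n) : Alive A X b m :=
  fun k hk => h k (hk.trans hmn)

lemma loopErasure_congr {X Y : ℕ → V} {n : ℕ} (h : ∀ i ≤ n, X i = Y i) :
    loopErasure X n = loopErasure Y n := by
  induction n with
  | zero => simp [loopErasure, h 0 le_rfl]
  | succ n ih =>
    simp only [loopErasure]
    rw [ih fun i hi => h i (hi.trans n.le_succ), h (n + 1) le_rfl]

lemma formsCycle_congr {X Y : ℕ → V} {n : ℕ} (h : ∀ i ≤ n, X i = Y i) (c : OrientedCycle G) :
    FormsCycle X c n ↔ FormsCycle Y c n := by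
  cases n with
  | zero => rfl
  | succ n =>
    simp only [FormsCycle]
    rw [loopErasure_congr fun i hi => h i (hi.trans n.le_succ), h (n + 1) le_rfl]

lemma alive_congr {A : Finset V} {X Y : ℕ → V} {b b' : OrientedCycle G → ℕ → Bool} {n : ℕ}
    (h : ∀ i ≤ n, X i = Y i) (hb : ∀ c, ∀ i ≤ n, b c i = b' c i) :
    Alive A X b n ↔ Alive A Y b' n := by
  refine forall₂_congr fun m hm => ?_
  rw [h m hm]
  refine and_congr_right fun _ => forall_congr' fun c => ?_
  rw [formsCycle_congr (fun i hi => h i (hi.trans hm)), hb c m hm]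

lemma loopErasure_eq_append (X : ℕ → V) (n : ℕ) : ∃ l, loopErasure X n = l ++ [X n] := by
  cases n with
  | zero => exact ⟨[], rfl⟩
  | succ n => exact ⟨_, rfl⟩

lemma head_loopErasure (X : ℕ → V) (n : ℕ) : (loopErasure X n).head? = some (X 0) := by
  induction n with
  | zero => rfl
  | succ n ih =>
    obtain ⟨l, hl⟩ : ∃ l, loopErasure X n = X 0 :: l := List.head?_eq_some_iff.1 ih
    simp only [loopErasure, hl, List.takeWhile_cons]
    split_ifs with h
    · simp
    · simp only [decide_eq_true_eq, not_not] at h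
      simp [h]

lemma loopErasure_nodup (X : ℕ → V) (n : ℕ) : (loopErasure X n).Nodup := by
  induction n with
  | zero => simp [loopErasure]
  | succ n ih =>
    simp only [loopErasure]
    rw [List.nodup_append]
    refine ⟨ih.sublist (List.takeWhile_sublist _), List.nodup_singleton _, ?_⟩
    rintro a ha b hb rfl
    rw [List.mem_singleton] at hb
    subst hb
    exact notMem_takeWhile _ _ ha

lemma mem_loopErasure {X : ℕ → V} {n : ℕ} {a : V} (h : a ∈ loopErasure X n) :
    ∃ m ≤ n, X m = a := by
  induction n with
  | zero => exact ⟨0, le_rfl, by simpa [loopErasure, eq_comm] using h⟩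
  | succ n ih =>
    simp only [loopErasure, List.mem_append, List.mem_singleton] at h
    rcases h with h | h
    · obtain ⟨m, hm, e⟩ := ih ((List.takeWhile_sublist _).subset h)
      exact ⟨m, hm.trans n.le_succ, e⟩
    · exact ⟨n + 1, le_rfl, h.symm⟩

lemma loopErasure_adj {X : ℕ → V} (hX : ∀ n, G.Adj (X n) (X (n + 1))) (n : ℕ) :
    ∀ a ∈ (loopErasure X n ++ [X (n + 1)]).zip (loopErasure X n ++ [X (n + 1)]).tail,
      G.Adj a.1 a.2 := by
  have hchain : ∀ l : List V, (∀ a ∈ l.zip l.tail, G.Adj a.1 a.2) ↔ l.IsChain G.Adj := by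
    intro l
    induction l with
    | nil => simp
    | cons a l ih =>
      cases l with
      | nil => simp
      | cons b l =>
        rw [List.isChain_cons_cons, ← ih]
        simp
  rw [hchain]
  induction n with
  | zero => simpa [loopErasure] using hX 0
  | succ n ih =>
    have hpre : (loopErasure X (n + 1)).IsChain G.Adj := by
      by_cases hmem : X (n + 1) ∈ loopErasure X n
      · obtain ⟨m, hm, _⟩ := eq_takeWhile_append _ _ hmem
        refine ih.prefix ?_
        simp only [loopErasure]
        refine List.IsPrefix.trans ?_ (List.prefix_append _ _)
        conv_rhs => rw [hm]
        exact ⟨m, by simp⟩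
      · simp only [loopErasure]
        rwa [takeWhile_of_notMem hmem]
    obtain ⟨l, hl⟩ := loopErasure_eq_append X (n + 1)
    rw [hl] at hpre ⊢
    rw [List.append_assoc]
    refine List.isChain_append.2 ?_
    rw [List.isChain_append] at hpre
    exact ⟨hpre.1, by simpa using hX (n + 1), by simpa using hpre.2.2⟩

variable [Fintype V]

lemma formsCycle_succ {X : ℕ → V} {c : OrientedCycle G} {n : ℕ} :
    FormsCycle X c (n + 1) ↔ c ∈ formed G (loopErasure X n) (X (n + 1)) := by
  rw [mem_formed]; rfl

lemma alive_succ {A : Finset V} {X : ℕ → V} {b : OrientedCycle G → ℕ → Bool} {n : ℕ} :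
    Alive A X b (n + 1) ↔ Alive A X b n ∧ X (n + 1) ∉ A ∧
      ∀ c ∈ formed G (loopErasure X n) (X (n + 1)), b c (n + 1) = false := by
  constructor
  · intro h
    refine ⟨h.mono n.le_succ, (h _ le_rfl).1, fun c hc => (h _ le_rfl).2 c (formsCycle_succ.2 hc)⟩
  · rintro ⟨h1, h2, h3⟩ m hm
    rcases Nat.le_succ_iff.1 hm with hm | rfl
    · exact h1 m hm
    · exact ⟨h2, fun c hc => h3 c (formsCycle_succ.1 hc)⟩

lemma alive_zero {A : Finset V} {X : ℕ → V} {b : OrientedCycle G → ℕ → Bool} :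
    Alive A X b 0 ↔ X 0 ∉ A := by
  simp [Alive, FormsCycle]

lemma Alive.mem_paths {A : Finset V} {X : ℕ → V} {b : OrientedCycle G → ℕ → Bool} {n : ℕ}
    (h : Alive A X b n) : loopErasure X n ∈ paths A := by
  rw [CyclePopping.mem_paths]
  refine ⟨loopErasure_nodup X n, fun a ha => ?_⟩
  obtain ⟨m, hm, rfl⟩ := mem_loopErasure ha
  exact (h m hm).1

lemma lastStep_loopErasure (W : EdgeWeights G) (X : ℕ → V) (n : ℕ) (z : V) :
    lastStep W (loopErasure X n) z = transProb W (X n) z := by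
  obtain ⟨l, hl⟩ := loopErasure_eq_append X n
  rw [hl, lastStep_append]

end Alive

/-! ### Laws of finite portions of a walk and of its acceptance bits -/

section Law

lemma measureReal_eq_sum_inter {Ω ι : Type*} [MeasurableSpace Ω] (μ : Measure Ω)
    [IsFiniteMeasure μ] (s : Finset ι) {E : Set Ω} (F : ι → Set Ω) (hE : MeasurableSet E)
    (hF : ∀ i ∈ s, MeasurableSet (F i)) (hd : (s : Set ι).PairwiseDisjoint F)
    (hcov : ∀ ω ∈ E, ∃ i ∈ s, ω ∈ F i) : μ.real E = ∑ i ∈ s, μ.real (E ∩ F i) := by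
  rw [← measureReal_biUnion_finset]
  · congr 1
    ext ω
    simp only [Set.mem_iUnion, Set.mem_inter_iff, exists_prop]
    exact ⟨fun h => (hcov ω h).imp fun i hi => ⟨hi.1, h, hi.2⟩, fun ⟨i, _, h, _⟩ => h⟩
  · intro i hi j hj hij
    exact (hd hi hj hij).mono Set.inter_subset_right Set.inter_subset_right
  · exact fun i hi => hE.inter (hF i hi)

variable {V : Type u} [Fintype V] [DecidableEq V] [MeasurableSpace V] [MeasurableSingletonClass V]
  {G : SimpleGraph V}

/-- An event which depends on finitely many times only is measurable. -/
lemma measurableSet_of_prefix (n : ℕ) (S : Set ((ℕ → V) × (OrientedCycle G → ℕ → Bool)))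
    (h : ∀ p q : (ℕ → V) × (OrientedCycle G → ℕ → Bool), (∀ i ≤ n, p.1 i = q.1 i) →
      (∀ c, ∀ i ≤ n, p.2 c i = q.2 c i) → p ∈ S → q ∈ S) : MeasurableSet S := by
  let r : (ℕ → V) × (OrientedCycle G → ℕ → Bool) →
      (Fin (n + 1) → V) × (OrientedCycle G → Fin (n + 1) → Bool) :=
    fun p => (fun i => p.1 i, fun c i => p.2 c i)
  have hr : Measurable r := by
    refine Measurable.prodMk ?_ ?_
    · exact measurable_pi_lambda _ fun i => (measurable_pi_apply _).comp measurable_fst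
    · exact measurable_pi_lambda _ fun c => measurable_pi_lambda _ fun i =>
        (measurable_pi_apply _).comp ((measurable_pi_apply _).comp measurable_snd)
  have hS : S = r ⁻¹' (r '' S) := by
    refine Set.Subset.antisymm (Set.subset_preimage_image r S) ?_
    rintro q ⟨p, hp, hpq⟩
    have h1 := congrArg Prod.fst hpq
    have h2 := congrArg Prod.snd hpq
    refine h p q (fun i hi => ?_) (fun c i hi => ?_) hp
    · exact congrFun h1 ⟨i, Nat.lt_succ_of_le hi⟩
    · exact congrFun (congrFun h2 c) ⟨i, Nat.lt_succ_of_le hi⟩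
  rw [hS]
  exact hr (Set.toFinite _).measurableSet

variable {W : EdgeWeights G} {φ : Connection G} {Ω : Type v} [MeasurableSpace Ω] {μ : Measure Ω}
  {X : V → ℕ → Ω → V} {B : V → OrientedCycle G → ℕ → Ω → Bool}

/-- The walk and the acceptance bits attached to the node `x`. -/
def nodeData (X : V → ℕ → Ω → V) (B : V → OrientedCycle G → ℕ → Ω → Bool) (x : V) (ω : Ω) :
    (ℕ → V) × (OrientedCycle G → ℕ → Bool) :=
  (fun n => X x n ω, fun c n => B x c n ω)

lemma measurable_nodeData (h : IsDriving W φ μ X B) (x : V) : Measurable (nodeData X B x) :=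
  Measurable.prodMk (measurable_pi_lambda _ fun n => h.measurable_walk x n)
    (measurable_pi_lambda _ fun c => measurable_pi_lambda _ fun n => h.measurable_bit x c n)

/-- The probability that the Bernoulli variable of the cycle `c` takes a given value. -/
def bitProb (φ : Connection G) (β : Bool) (c : OrientedCycle G) : ℝ :=
  if β then alpha φ c else 1 - alpha φ c

variable [IsProbabilityMeasure μ]

lemma measureReal_bit (h : IsDriving W φ μ X B) (x : V) (c : OrientedCycle G) (n : ℕ) (β : Bool) :
    μ.real {ω | B x c n ω = β} = bitProb φ β c := by
  have htrue : μ.real {ω | B x c n ω = true} = alpha φ c := by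
    rw [measureReal_def, h.bit_law, ENNReal.toReal_ofReal (alpha_nonneg φ c)]
  cases β with
  | true => simpa [bitProb] using htrue
  | false =>
    have hm : MeasurableSet {ω | B x c n ω = true} :=
      h.measurable_bit x c n (measurableSet_singleton true)
    have hc : {ω | B x c n ω = false} = {ω | B x c n ω = true}ᶜ := by
      ext ω; simp
    rw [hc, measureReal_compl hm, htrue]
    simp [bitProb]

lemma measureReal_bits (h : IsDriving W φ μ X B) (x : V) (T : Finset (OrientedCycle G × ℕ))
    (β : OrientedCycle G × ℕ → Bool) :
    μ.real {ω | ∀ t ∈ T, B x t.1 t.2 ω = β t} = ∏ t ∈ T, bitProb φ (β t) t.1 := by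
  have hi := (h.indep_bits x).measure_inter_preimage_eq_mul T (sets := fun t => {β t})
    (fun t _ => measurableSet_singleton _)
  have hset : {ω | ∀ t ∈ T, B x t.1 t.2 ω = β t} =
      ⋂ i ∈ T, (fun ω => B x i.1 i.2 ω) ⁻¹' {β i} := by
    ext ω; simp
  rw [measureReal_def, hset, hi, ENNReal.toReal_prod]
  exact Finset.prod_congr rfl fun t _ => measureReal_bit h x t.1 t.2 (β t)

lemma measureReal_cylinder (h : IsDriving W φ μ X B) (x : V) (n : ℕ) (y : ℕ → V)
    (T : Finset (OrientedCycle G × ℕ)) (β : OrientedCycle G × ℕ → Bool) :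
    μ.real {ω | (∀ i ≤ n, X x i ω = y i) ∧ ∀ t ∈ T, B x t.1 t.2 ω = β t} =
      (if y 0 = x then ∏ i ∈ Finset.range n, transProb W (y i) (y (i + 1)) else 0) *
        ∏ t ∈ T, bitProb φ (β t) t.1 := by
  have hS : MeasurableSet {p : ℕ → V | ∀ i ≤ n, p i = y i} := by
    simp only [Set.ofPred_forall]
    exact MeasurableSet.iInter fun i => MeasurableSet.iInter fun _ =>
      measurable_pi_apply i (measurableSet_singleton _)
  have hT : MeasurableSet {b : OrientedCycle G → ℕ → Bool | ∀ t ∈ T, b t.1 t.2 = β t} := by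
    simp only [Set.ofPred_forall]
    exact MeasurableSet.iInter fun t => MeasurableSet.iInter fun _ =>
      ((measurable_pi_apply t.2).comp (measurable_pi_apply t.1)) (measurableSet_singleton _)
  have hi := (h.indep_walk_bits x).measure_inter_preimage_eq_mul _ _ hS hT
  have hset : {ω | (∀ i ≤ n, X x i ω = y i) ∧ ∀ t ∈ T, B x t.1 t.2 ω = β t} =
      (fun ω n => X x n ω) ⁻¹' {p : ℕ → V | ∀ i ≤ n, p i = y i} ∩
        (fun ω c n => B x c n ω) ⁻¹'
          {b : OrientedCycle G → ℕ → Bool | ∀ t ∈ T, b t.1 t.2 = β t} := rfl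
  rw [measureReal_def, hset, hi, ENNReal.toReal_mul]
  congr 1
  · change (μ {ω | ∀ i ≤ n, X x i ω = y i}).toReal = _
    rw [h.walk_law]
    split_ifs
    · rw [ENNReal.toReal_prod]
      exact Finset.prod_congr rfl fun i _ => ENNReal.toReal_ofReal (transProb_nonneg W _ _)
    · rfl
  · exact measureReal_bits h x T β

/-- The event that the walk from `x` has not been stopped at time `n` and has loop erasure `l`. -/
def visitEvent (X : V → ℕ → Ω → V) (B : V → OrientedCycle G → ℕ → Ω → Bool) (A : Finset V) (x : V)
    (n : ℕ) (l : List V) : Set Ω :=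
  {ω | loopErasure (fun i => X x i ω) n = l ∧ Alive A (fun i => X x i ω) (fun c i => B x c i ω) n}

lemma measurableSet_visitEvent (h : IsDriving W φ μ X B) (A : Finset V) (x : V) (n : ℕ)
    (l : List V) : MeasurableSet (visitEvent X B A x n l) := by
  refine measurable_nodeData h x (t := {p | loopErasure p.1 n = l ∧ Alive A p.1 p.2 n}) ?_
  refine measurableSet_of_prefix n _ fun p q h1 h2 hp => ?_
  exact ⟨(loopErasure_congr h1).symm.trans hp.1, (alive_congr h1 h2).1 hp.2⟩

open Classical in
/-- The pairs of a cycle and a time `≤ n` such that the trajectory `y` forms the cycle at this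
time. -/
def formedUpTo (G : SimpleGraph V) (y : ℕ → V) (n : ℕ) : Finset (OrientedCycle G × ℕ) :=
  (Finset.univ ×ˢ Finset.range (n + 1)).filter fun t => FormsCycle y t.1 t.2

lemma mem_formedUpTo {y : ℕ → V} {n : ℕ} {t : OrientedCycle G × ℕ} :
    t ∈ formedUpTo G y n ↔ t.2 ≤ n ∧ FormsCycle y t.1 t.2 := by
  simp [formedUpTo]

/-- Markov property of the walk together with its acceptance bits: the step at time `n + 1` and the
bits at that time are independent of the past. -/
lemma measureReal_step (h : IsDriving W φ μ X B) (A : Finset V) (x : V) (n : ℕ) (l : List V) (z : V)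
    (D : Finset (OrientedCycle G)) (β : Bool) :
    μ.real (visitEvent X B A x n l ∩ {ω | X x (n + 1) ω = z ∧ ∀ c ∈ D, B x c (n + 1) ω = β}) =
      μ.real (visitEvent X B A x n l) * (lastStep W l z * ∏ c ∈ D, bitProb φ β c) := by
  classical
  -- both sides are decomposed according to the trajectory up to time `n`
  let F : (Fin (n + 1) → V) → Set Ω := fun y => {ω | ∀ i : Fin (n + 1), X x i ω = y i}
  have hF : ∀ y ∈ Finset.univ, MeasurableSet (F y) := by
    intro y _
    simp only [F, Set.ofPred_forall]
    exact MeasurableSet.iInter fun i => h.measurable_walk x i (measurableSet_singleton _)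
  have hd : ((Finset.univ : Finset (Fin (n + 1) → V)) : Set _).PairwiseDisjoint F := by
    intro y _ y' _ hne
    rw [Function.onFun, Set.disjoint_left]
    intro ω h1 h2
    exact hne (funext fun i => (h1 i).symm.trans (h2 i))
  have hcov : ∀ ω, ∃ y ∈ (Finset.univ : Finset (Fin (n + 1) → V)), ω ∈ F y :=
    fun ω => ⟨fun i => X x i ω, Finset.mem_univ _, fun i => rfl⟩
  have hE := measurableSet_visitEvent h A x n l
  have hE' : MeasurableSet {ω | X x (n + 1) ω = z ∧ ∀ c ∈ D, B x c (n + 1) ω = β} := by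
    refine MeasurableSet.inter (h.measurable_walk x (n + 1) (measurableSet_singleton z))
      (?_ : MeasurableSet {ω | ∀ c ∈ D, B x c (n + 1) ω = β})
    simp only [Set.ofPred_forall]
    exact MeasurableSet.iInter fun c => MeasurableSet.iInter fun _ =>
      h.measurable_bit x c (n + 1) (measurableSet_singleton _)
  rw [measureReal_eq_sum_inter μ Finset.univ F (hE.inter hE') hF hd (fun ω _ => hcov ω),
    measureReal_eq_sum_inter μ Finset.univ F hE hF hd (fun ω _ => hcov ω), Finset.sum_mul]
  refine Finset.sum_congr rfl fun y _ => ?_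
  -- the trajectory `y` followed by the step to `z`
  let y' : ℕ → V := fun i => if hi : i < n + 1 then y ⟨i, hi⟩ else z
  have hagree : ∀ ω, ω ∈ F y ↔ ∀ i ≤ n, X x i ω = y' i := by
    intro ω
    constructor
    · intro hω i hi
      have hi' : i < n + 1 := Nat.lt_succ_of_le hi
      have hy' : y' i = y ⟨i, hi'⟩ := dif_pos hi'
      rw [hy']
      exact hω ⟨i, hi'⟩
    · intro hω i
      exact (hω i (Nat.le_of_lt_succ i.2)).trans (dif_pos i.2)
  by_cases hy : loopErasure y' n = l ∧ ∀ m ≤ n, y' m ∉ A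
  -- given the trajectory, the event is a cylinder for the walk and finitely many bits
  · have hpast : visitEvent X B A x n l ∩ F y =
        {ω | (∀ i ≤ n, X x i ω = y' i) ∧ ∀ t ∈ formedUpTo G y' n, B x t.1 t.2 ω = false} := by
      ext ω
      rw [Set.mem_inter_iff, hagree, and_comm]
      refine and_congr_right fun hω => ?_
      simp only [visitEvent, Set.mem_ofPred_eq, Alive, mem_formedUpTo]
      constructor
      · rintro ⟨_, h2⟩ t ⟨ht1, ht2⟩
        exact (h2 t.2 ht1).2 t.1 ((formsCycle_congr (fun i hi => hω i (hi.trans ht1)) _).2 ht2)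
      · intro h2
        refine ⟨(loopErasure_congr hω).trans hy.1, fun m hm => ⟨?_, fun c hc => ?_⟩⟩
        · rw [hω m hm]; exact hy.2 m hm
        · exact h2 (c, m) ⟨hm, (formsCycle_congr (fun i hi => hω i (hi.trans hm)) _).1 hc⟩
    have hnew : visitEvent X B A x n l ∩
        {ω | X x (n + 1) ω = z ∧ ∀ c ∈ D, B x c (n + 1) ω = β} ∩ F y =
        {ω | (∀ i ≤ n + 1, X x i ω = y' i) ∧
          ∀ t ∈ formedUpTo G y' n ∪ D.image (fun c => (c, n + 1)),
            B x t.1 t.2 ω = if t.2 = n + 1 then β else false} := by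
      rw [Set.inter_right_comm, hpast]
      have hz : y' (n + 1) = z := by simp [y']
      ext ω
      simp only [Set.mem_inter_iff, Set.mem_ofPred_eq, Finset.mem_union, Finset.mem_image]
      constructor
      · rintro ⟨⟨h1, h2⟩, h3, h4⟩
        refine ⟨fun i hi => ?_, ?_⟩
        · rcases Nat.le_succ_iff.1 hi with hi | rfl
          · exact h1 i hi
          · rw [hz, h3]
        · rintro t (ht | ⟨c, hc, rfl⟩)
          · have := (mem_formedUpTo.1 ht).1
            rw [if_neg (by omega)]
            exact h2 t ht
          · simpa using h4 c hc
      · rintro ⟨h1, h2⟩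
        refine ⟨⟨fun i hi => h1 i (hi.trans n.le_succ), fun t ht => ?_⟩,
          (h1 _ le_rfl).trans hz, fun c hc => ?_⟩
        · have := (mem_formedUpTo.1 ht).1
          rw [h2 t (Or.inl ht), if_neg (by omega)]
        · rw [h2 (c, n + 1) (Or.inr ⟨c, hc, rfl⟩), if_pos rfl]
    have hdisj : Disjoint (formedUpTo G y' n) (D.image fun c => (c, n + 1)) := by
      rw [Finset.disjoint_left]
      intro t ht ht'
      obtain ⟨c, _, rfl⟩ := Finset.mem_image.1 ht'
      have := (mem_formedUpTo.1 ht).1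
      simp at this
    rw [hnew, hpast, measureReal_cylinder h, measureReal_cylinder h x n y' _ (fun _ => false),
      Finset.prod_union hdisj, Finset.prod_image (by intro c _ c' _ hcc; simpa using hcc),
      Finset.prod_range_succ]
    have h1 : ∏ t ∈ formedUpTo G y' n, bitProb φ (if t.2 = n + 1 then β else false) t.1 =
        ∏ t ∈ formedUpTo G y' n, bitProb φ false t.1 := by
      refine Finset.prod_congr rfl fun t ht => ?_
      have := (mem_formedUpTo.1 ht).1
      rw [if_neg (by omega)]
    have hz : y' (n + 1) = z := by simp [y']
    rw [h1, ← hy.1, lastStep_loopErasure, hz]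
    simp only [if_true]
    split_ifs
    · ring
    · simp
  · have hempty : visitEvent X B A x n l ∩ F y = ∅ := by
      rw [Set.eq_empty_iff_forall_notMem]
      rintro ω ⟨⟨h1, h2⟩, h3⟩
      rw [hagree] at h3
      refine hy ⟨(loopErasure_congr h3).symm.trans h1, fun m hm => ?_⟩
      rw [← h3 m hm]
      exact (h2 m hm).1
    rw [Set.inter_right_comm, hempty]
    simp

end Law

/-! ### Termination and law of a single branch -/

section Branch

variable {V : Type u} [Fintype V] [DecidableEq V] [MeasurableSpace V] [MeasurableSingletonClass V]
  {G : SimpleGraph V} {W : EdgeWeights G} {φ : Connection G} {Ω : Type v} [MeasurableSpace Ω]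
  {μ : Measure Ω} [IsProbabilityMeasure μ]
  {X : V → ℕ → Ω → V} {B : V → OrientedCycle G → ℕ → Ω → Bool}

lemma ae_start (h : IsDriving W φ μ X B) : ∀ᵐ ω ∂μ, ∀ x, X x 0 ω = x := by
  rw [ae_all_iff]
  intro x
  have hm : MeasurableSet {ω | X x 0 ω = x} := h.measurable_walk x 0 (measurableSet_singleton x)
  have h1 : μ {ω | X x 0 ω = x} = 1 := by
    have := h.walk_law x 0 (fun _ => x)
    simpa using this
  exact (prob_compl_eq_zero_iff hm).2 h1

lemma measureReal_visitEvent_zero (h : IsDriving W φ μ X B) {A : Finset V} {x : V} (hx : x ∉ A)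
    (l : List V) : μ.real (visitEvent X B A x 0 l) = if l = [x] then 1 else 0 := by
  have hset : visitEvent X B A x 0 l =ᵐ[μ] {_ω : Ω | l = [x]} := by
    filter_upwards [ae_start h] with ω hω
    refine propext ?_
    change (loopErasure (fun i => X x i ω) 0 = l ∧ Alive A _ _ 0) ↔ l = [x]
    rw [alive_zero]
    simp [loopErasure, hω x, hx, eq_comm]
  rw [measureReal_congr hset]
  split_ifs with hl <;> simp [hl]

lemma measureReal_visitEvent_succ (h : IsDriving W φ μ X B) (A : Finset V) (x : V) (n : ℕ)
    (l : List V) :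
    μ.real (visitEvent X B A x (n + 1) l) =
      ∑ l' ∈ paths A, μ.real (visitEvent X B A x n l') * pathKernel W φ A l' l := by
  let F : List V × V → Set Ω := fun i => visitEvent X B A x n i.1 ∩ {ω | X x (n + 1) ω = i.2}
  have hF : ∀ i ∈ paths A ×ˢ (Finset.univ : Finset V), MeasurableSet (F i) := fun i _ =>
    (measurableSet_visitEvent h A x n i.1).inter
      (h.measurable_walk x (n + 1) (measurableSet_singleton i.2))
  have hd : ((paths A ×ˢ (Finset.univ : Finset V) : Finset _) : Set _).PairwiseDisjoint F := by
    intro i _ j _ hij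
    rw [Function.onFun, Set.disjoint_left]
    intro ω h1 h2
    exact hij (Prod.ext (h1.1.1.symm.trans h2.1.1) (h1.2.symm.trans h2.2))
  have hcov : ∀ ω ∈ visitEvent X B A x (n + 1) l,
      ∃ i ∈ paths A ×ˢ (Finset.univ : Finset V), ω ∈ F i := by
    intro ω hω
    have halive := hω.2.mono n.le_succ
    exact ⟨(_, X x (n + 1) ω), by simpa using mem_paths.1 halive.mem_paths, ⟨rfl, halive⟩, rfl⟩
  rw [measureReal_eq_sum_inter μ _ F (measurableSet_visitEvent h A x (n + 1) l) hF hd hcov,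
    Finset.sum_product]
  refine Finset.sum_congr rfl fun l' _ => ?_
  rw [pathKernel, Finset.mul_sum]
  refine Finset.sum_congr rfl fun z _ => ?_
  split_ifs with hz
  · have hset : visitEvent X B A x (n + 1) l ∩ F (l', z) = visitEvent X B A x n l' ∩
        {ω | X x (n + 1) ω = z ∧ ∀ c ∈ formed G l' z, B x c (n + 1) ω = false} := by
      ext ω
      constructor
      · rintro ⟨⟨_, h2⟩, h3, h4⟩
        replace h4 : X x (n + 1) ω = z := h4
        refine ⟨h3, h4, fun c hc => ?_⟩
        refine (alive_succ.1 h2).2.2 c ?_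
        rw [h3.1, h4]; exact hc
      · rintro ⟨h3, h4, h5⟩
        refine ⟨⟨?_, ?_⟩, h3, h4⟩
        · simp only [loopErasure]
          rw [h3.1]
          subst h4
          exact hz.2
        · rw [alive_succ, h3.1, h4]
          exact ⟨h3.2, hz.1, h5⟩
    rw [hset, measureReal_step h]
    rfl
  · have hset : visitEvent X B A x (n + 1) l ∩ F (l', z) = ∅ := by
      rw [Set.eq_empty_iff_forall_notMem]
      rintro ω ⟨⟨h1, h2⟩, h3, h4⟩
      replace h4 : X x (n + 1) ω = z := h4
      refine hz ⟨?_, ?_⟩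
      · rw [← h4]; exact (alive_succ.1 h2).2.1
      · have h3' : loopErasure (fun i => X x i ω) n = l' := h3.1
        subst h4
        rw [← h1, ← h3']
        rfl
    rw [hset]
    simp

/-- The walk follows a given self-avoiding path with positive probability. -/
lemma measureReal_visitEvent_pos (h : IsDriving W φ μ X B) (hweak : WeaklyInconsistent φ)
    {A : Finset V} {x : V} (hx : x ∉ A) (l : List V) :
    l ∈ paths A → l.head? = some x → arcsProd W.w l ≠ 0 →
      ∃ n, μ.real (visitEvent X B A x n l) ≠ 0 := by
  induction l using List.reverseRecOn with
  | nil => intro _ h; simp at h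
  | append_singleton l y ih =>
    intro hl hhead hw
    rcases List.eq_nil_or_concat l with rfl | ⟨l', y', hl'⟩
    · refine ⟨0, ?_⟩
      have : y = x := by simpa using hhead
      rw [measureReal_visitEvent_zero h hx, this]
      simp
    · rw [List.concat_eq_append] at hl'
      have hyA : y ∉ A := (mem_paths.1 hl).2 y (by simp)
      have hyl : y ∉ l := fun h' =>
        (List.nodup_append.1 (mem_paths.1 hl).1).2.2 y h' y (by simp) rfl
      have hl0 : l ∈ paths A := by
        rw [mem_paths] at hl ⊢
        exact ⟨(List.nodup_append.1 hl.1).1, fun a ha => hl.2 a (by simp [ha])⟩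
      have hhead' : l.head? = some x := by
        rw [hl'] at hhead ⊢
        cases l' <;> simpa using hhead
      have hsplit : arcsProd W.w (l ++ [y]) = arcsProd W.w l * W.w y' y := by
        rw [hl', arcsProd_append_pair]
      rw [hsplit] at hw
      obtain ⟨n, hn⟩ := ih hl0 hhead' (left_ne_zero_of_mul hw)
      refine ⟨n + 1, ?_⟩
      rw [measureReal_visitEvent_succ h]
      refine (lt_of_lt_of_le ?_ (Finset.single_le_sum (f := fun l' =>
        μ.real (visitEvent X B A x n l') * pathKernel W φ A l' (l ++ [y]))
        (fun l' _ => mul_nonneg measureReal_nonneg (pathKernel_nonneg W φ hweak A l' _)) hl0)).ne'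
      refine mul_pos (lt_of_le_of_ne measureReal_nonneg hn.symm) ?_
      rw [pathKernel_append W φ _ _ hyA, if_pos (takeWhile_of_notMem hyl),
        rejectProb_of_notMem φ hyl, mul_one, hl', lastStep_append]
      refine lt_of_le_of_ne (transProb_nonneg W _ _) fun h0 => ?_
      apply right_ne_zero_of_mul hw
      rw [← deg_mul_transProb, ← h0, mul_zero]

/-- The expected number of visits of each loop-erased path. -/
lemma hasSum_visits (hG : G.Connected) (hφ : Nontrivial φ) (hweak : WeaklyInconsistent φ)
    (h : IsDriving W φ μ X B) {A : Finset V} {x : V} (hx : x ∉ A) {l : List V} (hl : l ∈ paths A) :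
    HasSum (fun n => μ.real (visitEvent X B A x n l)) (visits W φ A x l) := by
  refine hasSum_of_fixedPoint (paths A) (pathKernel W φ A) (pathKernel_nonneg W φ hweak A)
    (fun n l => μ.real (visitEvent X B A x n l)) (fun n l => measureReal_nonneg)
    (fun n l _ => measureReal_visitEvent_succ h A x n l) (visits W φ A x)
    (visits_nonneg hG W φ hφ A x) (fun l hl => ?_) (fun l hl h0 => ?_) l hl
  · rw [measureReal_visitEvent_zero h hx]
    exact visits_fixedPoint hG W φ hφ A l hl
  · unfold visits at h0
    split_ifs at h0 with hhead
    · refine measureReal_visitEvent_pos h hweak hx l hl hhead fun h1 => h0 ?_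
      rw [h1]
      simp
    · exact absurd rfl h0

/-- Almost surely, each walk is stopped. -/
lemma ae_exists_not_alive (hG : G.Connected) (hφ : Nontrivial φ) (hweak : WeaklyInconsistent φ)
    (h : IsDriving W φ μ X B) {A : Finset V} {x : V} (hx : x ∉ A) :
    ∀ᵐ ω ∂μ, ∃ n, ¬ Alive A (fun i => X x i ω) (fun c i => B x c i ω) n := by
  have hbound : ∀ n, μ.real {ω | ∀ n, Alive A (fun i => X x i ω) (fun c i => B x c i ω) n} ≤
      ∑ l ∈ paths A, μ.real (visitEvent X B A x n l) := by
    intro n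
    refine (measureReal_mono (s₂ := ⋃ l ∈ paths A, visitEvent X B A x n l) ?_
      (measure_ne_top _ _)).trans
      (measureReal_biUnion_finset_le _ _)
    intro ω hω
    simp only [Set.mem_iUnion]
    exact ⟨_, (hω n).mem_paths, rfl, hω n⟩
  have hlim : Filter.Tendsto (fun n => ∑ l ∈ paths A, μ.real (visitEvent X B A x n l))
      Filter.atTop (nhds 0) := by
    have := tendsto_finsetSum (paths A) fun l hl =>
      (hasSum_visits hG hφ hweak h hx hl).summable.tendsto_atTop_zero
    simpa using this
  have hzero : μ.real {ω | ∀ n, Alive A (fun i => X x i ω) (fun c i => B x c i ω) n} = 0 :=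
    le_antisymm (ge_of_tendsto' hlim hbound) measureReal_nonneg
  rw [measureReal_eq_zero_iff] at hzero
  rw [ae_iff]
  simpa using hzero

/-- The walk is stopped by the step to `z`, when its loop-erased path is `l`. -/
def StopsWith (A : Finset V) (X : ℕ → V) (b : OrientedCycle G → ℕ → Bool) (l : List V) (z : V) :
    Prop :=
  ∃ n, loopErasure X n = l ∧ Alive A X b n ∧ X (n + 1) = z ∧ ¬ Alive A X b (n + 1)

lemma measurableSet_stopsWith (A : Finset V) (l : List V) (z : V) :
    MeasurableSet {p : (ℕ → V) × (OrientedCycle G → ℕ → Bool) | StopsWith A p.1 p.2 l z} := by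
  simp only [StopsWith, Set.ofPred_exists]
  refine MeasurableSet.iUnion fun n => measurableSet_of_prefix (n + 1) _ fun p q h1 h2 hp => ?_
  have h1' : ∀ i ≤ n, p.1 i = q.1 i := fun i hi => h1 i (hi.trans n.le_succ)
  have h2' : ∀ c, ∀ i ≤ n, p.2 c i = q.2 c i := fun c i hi => h2 c i (hi.trans n.le_succ)
  exact ⟨(loopErasure_congr h1').symm.trans hp.1, (alive_congr h1' h2').1 hp.2.1,
    (h1 _ le_rfl).symm.trans hp.2.2.1, fun h => hp.2.2.2 ((alive_congr h1 h2).2 h)⟩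

/-- The law of the branch: each term of the sum over the stopping times is the probability of a
visit of `l`, times that of the last step and of the acceptance of the cycle that it closes. -/
lemma measureReal_stopsWith (hG : G.Connected) (hφ : Nontrivial φ) (hweak : WeaklyInconsistent φ)
    (h : IsDriving W φ μ X B) {A : Finset V} {x : V} {l : List V} (hl : l ∈ paths A)
    (hhead : l.head? = some x) {z : V} (hz : z ∈ A ∨ (formed G l z).Nonempty) :
    μ.real {ω | StopsWith A (fun i => X x i ω) (fun c i => B x c i ω) l z} =
      arcsProd W.w (l ++ [z]) * (∏ c ∈ formed G l z, alpha φ c) *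
        (removedDet W φ (A ∪ l.toFinset) / removedDet W φ A) := by
  have hx : x ∉ A := (mem_paths.1 hl).2 x (List.mem_of_mem_head? hhead)
  let E : ℕ → Set Ω := fun n => visitEvent X B A x n l ∩
    {ω | X x (n + 1) ω = z ∧ ∀ c ∈ formed G l z, B x c (n + 1) ω = true}
  -- given its last step, the walk is killed at time `n + 1` exactly when the cycle that it forms,
  -- if any, is accepted: a step into `A` forms no cycle since `l` avoids `A`
  have hE_iff : ∀ n ω, ω ∈ E n ↔ loopErasure (fun i => X x i ω) n = l ∧
      Alive A (fun i => X x i ω) (fun c i => B x c i ω) n ∧ X x (n + 1) ω = z ∧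
      ¬ Alive A (fun i => X x i ω) (fun c i => B x c i ω) (n + 1) := by
    intro n ω
    constructor
    · rintro ⟨⟨h1, h2⟩, h3, h4⟩
      refine ⟨h1, h2, h3, fun h5 => ?_⟩
      rw [alive_succ, h1, h3] at h5
      rcases hz with hz | ⟨c, hc⟩
      · exact h5.2.1 hz
      · have := h5.2.2 c hc
        rw [h4 c hc] at this
        exact absurd this (by simp)
    · rintro ⟨h1, h2, h3, h4⟩
      refine ⟨⟨h1, h2⟩, h3, fun c hc => ?_⟩
      rw [alive_succ, h1, h3] at h4
      have hzl : z ∈ l := by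
        by_contra hzl
        rw [formed_eq_empty hzl] at hc
        simp at hc
      by_contra hb
      refine h4 ⟨h2, (mem_paths.1 hl).2 z hzl, fun c' hc' => ?_⟩
      rw [formed_eq_singleton hc, Finset.mem_singleton] at hc'
      subst hc'
      simpa using hb
  have hE : ∀ n, MeasurableSet (E n) := by
    intro n
    refine (measurableSet_visitEvent h A x n l).inter (MeasurableSet.inter
      (h.measurable_walk x (n + 1) (measurableSet_singleton z))
      (?_ : MeasurableSet {ω | ∀ c ∈ formed G l z, B x c (n + 1) ω = true}))
    simp only [Set.ofPred_forall]
    exact MeasurableSet.iInter fun c => MeasurableSet.iInter fun _ =>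
      h.measurable_bit x c (n + 1) (measurableSet_singleton _)
  have hdisj : Pairwise (Function.onFun Disjoint E) := by
    have hlt : ∀ m n, m < n → Disjoint (E m) (E n) := by
      intro m n hmn
      rw [Set.disjoint_left]
      intro ω h1 h2
      exact ((hE_iff m ω).1 h1).2.2.2 (((hE_iff n ω).1 h2).2.1.mono hmn)
    intro m n hmn
    rcases lt_or_gt_of_ne hmn with h' | h'
    · exact hlt m n h'
    · exact (hlt n m h').symm
  have hunion : {ω | StopsWith A (fun i => X x i ω) (fun c i => B x c i ω) l z} = ⋃ n, E n := by
    ext ω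
    rw [Set.mem_iUnion]
    exact exists_congr fun n => (hE_iff n ω).symm
  have hsum := (hasSum_visits hG hφ hweak h hx hl).mul_right
    (lastStep W l z * ∏ c ∈ formed G l z, bitProb φ true c)
  have hterm : ∀ n, μ.real (E n) = μ.real (visitEvent X B A x n l) *
      (lastStep W l z * ∏ c ∈ formed G l z, bitProb φ true c) := fun n =>
    measureReal_step h A x n l z (formed G l z) true
  simp only [← hterm] at hsum
  have hmeas : μ (⋃ n, E n) = ENNReal.ofReal (visits W φ A x l *
      (lastStep W l z * ∏ c ∈ formed G l z, bitProb φ true c)) := by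
    rw [measure_iUnion hdisj hE, ← hsum.tsum_eq,
      ENNReal.ofReal_tsum_of_nonneg (fun n => measureReal_nonneg) hsum.summable]
    exact tsum_congr fun n => (ofReal_measureReal).symm
  have hbit : ∀ c : OrientedCycle G, bitProb φ true c = alpha φ c := fun c => rfl
  rw [hunion, measureReal_def, hmeas, ENNReal.toReal_ofReal
    (hsum.nonneg fun n => measureReal_nonneg), ← mul_assoc, visits_mul_lastStep W φ A hhead]
  simp only [hbit]
  ring

lemma ae_step_adj (h : IsDriving W φ μ X B) :
    ∀ᵐ ω ∂μ, ∀ x n, G.Adj (X x n ω) (X x (n + 1) ω) := by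
  rw [ae_all_iff]; intro x
  rw [ae_all_iff]; intro n
  have hcyl : ∀ p : ℕ → V, ¬ G.Adj (p n) (p (n + 1)) → μ {ω | ∀ i ≤ n + 1, X x i ω = p i} = 0 := by
    intro p hp
    rw [h.walk_law, Finset.prod_eq_zero (Finset.self_mem_range_succ n), ite_self]
    simp [transProb, W.zero _ _ hp]
  have hnull : ∀ y z, ¬ G.Adj y z → μ {ω | X x n ω = y ∧ X x (n + 1) ω = z} = 0 := by
    intro y z hyz
    have hsub : {ω | X x n ω = y ∧ X x (n + 1) ω = z} ⊆
        ⋃ p : Fin n → V, {ω | ∀ i ≤ n + 1, X x i ω =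
          if hi : i < n then p ⟨i, hi⟩ else if i = n then y else z} := by
      rintro ω ⟨h1, h2⟩
      refine Set.mem_iUnion.2 ⟨fun i => X x i ω, fun i hi => ?_⟩
      by_cases hi1 : i < n
      · rw [dif_pos hi1]
      · by_cases hi2 : i = n
        · rw [dif_neg hi1, if_pos hi2, hi2, h1]
        · rw [dif_neg hi1, if_neg hi2, show i = n + 1 by omega, h2]
    refine measure_mono_null hsub (measure_iUnion_null fun p => ?_)
    refine hcyl _ ?_
    simpa using hyz
  rw [ae_iff]
  refine measure_mono_null (t := ⋃ y, ⋃ z, ⋃ (_ : ¬ G.Adj y z),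
    {ω | X x n ω = y ∧ X x (n + 1) ω = z}) ?_ ?_
  · intro ω hω
    simp only [Set.mem_iUnion]
    exact ⟨_, _, hω, rfl, rfl⟩
  · exact measure_iUnion_null fun y => measure_iUnion_null fun z => measure_iUnion_null fun hyz =>
      hnull y z hyz

lemma ae_bit_false (h : IsDriving W φ μ X B) :
    ∀ᵐ ω ∂μ, ∀ x c n, alpha φ c = 0 → B x c n ω = false := by
  rw [ae_all_iff]; intro x
  rw [ae_all_iff]; intro c
  rw [ae_all_iff]; intro n
  by_cases hc : alpha φ c = 0
  · have := h.bit_law x c n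
    rw [hc, ENNReal.ofReal_zero] at this
    rw [ae_iff]
    simpa [hc] using this
  · exact Filter.Eventually.of_forall fun ω h0 => absurd h0 hc

end Branch

/-! ### Stopping times and branches -/

section Stopping

variable {V : Type u} [DecidableEq V] {G : SimpleGraph V}

lemma lt_stopTime_iff {A : Finset V} {X : ℕ → V} {b : OrientedCycle G → ℕ → Bool} {n : ℕ} :
    (n : ℕ∞) < stopTime A X b ↔ Alive A X b n := by
  rw [← ENat.add_one_le_iff (ENat.natCast_ne_top n)]
  simp only [stopTime, hittingTime, cycleTime, le_inf_iff, le_iInf_iff]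
  constructor
  · rintro ⟨h1, h2⟩ m hm
    refine ⟨fun hA => ?_, fun c hc => ?_⟩
    · have := h1 m hA
      norm_cast at this
      omega
    · by_contra hb
      have := h2 c m ⟨hc, by simpa using hb⟩
      norm_cast at this
      omega
  · intro h
    refine ⟨fun m hA => ?_, fun c m hc => ?_⟩
    · norm_cast
      by_contra hm
      exact (h m (by omega)).1 hA
    · norm_cast
      by_contra hm
      have := (h m (by omega)).2 c hc.1
      rw [hc.2] at this
      simp at this

lemma StopsWith.branch_eq {A : Finset V} {X : ℕ → V} {b : OrientedCycle G → ℕ → Bool}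
    {l : List V} {z : V} (h : StopsWith A X b l z) : branch A X b = some (ofPath (l ++ [z])) := by
  obtain ⟨n, h1, h2, h3, h4⟩ := h
  rw [← lt_stopTime_iff] at h2 h4
  have hτ : stopTime A X b = ((n + 1 : ℕ) : ℕ∞) := by
    refine le_antisymm (not_lt.1 h4) ?_
    push_cast
    exact (ENat.add_one_le_iff (ENat.natCast_ne_top n)).2 h2
  rw [branch, hτ, if_neg (ENat.natCast_ne_top _), ENat.toNat_natCast, lastPath, h1, h3]

lemma exists_stopsWith_of_not_alive {A : Finset V} {X : ℕ → V} {b : OrientedCycle G → ℕ → Bool}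
    (h0 : X 0 ∉ A) {n : ℕ} (hn : ¬ Alive A X b n) : ∃ l z, StopsWith A X b l z := by
  have h0' : Alive A X b 0 := by
    intro m hm
    obtain rfl := Nat.le_zero.1 hm
    exact ⟨h0, fun c hc => absurd hc (by simp [FormsCycle])⟩
  induction n with
  | zero => exact absurd h0' hn
  | succ n ih =>
    by_cases h : Alive A X b n
    · exact ⟨_, _, n, rfl, h, rfl, hn⟩
    · exact ih h

lemma exists_stopsWith_of_branch {A : Finset V} {X : ℕ → V} {b : OrientedCycle G → ℕ → Bool}
    (h0 : X 0 ∉ A) {J : OrientedSubgraph V} (h : branch A X b = some J) :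
    ∃ l z, StopsWith A X b l z ∧ J = ofPath (l ++ [z]) := by
  have hτ : stopTime A X b ≠ ⊤ := by
    intro hτ
    rw [branch, if_pos hτ] at h
    simp at h
  obtain ⟨k, hk⟩ := ENat.ne_top_iff_exists.1 hτ
  have hna : ¬ Alive A X b k := by
    rw [← lt_stopTime_iff, ← hk]
    exact lt_irrefl _
  obtain ⟨l, z, hs⟩ := exists_stopsWith_of_not_alive h0 hna
  refine ⟨l, z, hs, ?_⟩
  rw [hs.branch_eq] at h
  exact (Option.some_inj.1 h).symm

variable [Fintype V]

lemma StopsWith.mem_paths {A : Finset V} {X : ℕ → V} {b : OrientedCycle G → ℕ → Bool}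
    {l : List V} {z : V} (h : StopsWith A X b l z) : l ∈ paths A := by
  obtain ⟨n, rfl, h2, -⟩ := h
  exact h2.mem_paths

lemma StopsWith.head {A : Finset V} {X : ℕ → V} {b : OrientedCycle G → ℕ → Bool}
    {l : List V} {z : V} (h : StopsWith A X b l z) : l.head? = some (X 0) := by
  obtain ⟨n, rfl, -⟩ := h
  exact head_loopErasure X n

lemma StopsWith.mem_or_accepted {A : Finset V} {X : ℕ → V} {b : OrientedCycle G → ℕ → Bool}
    {l : List V} {z : V} (h : StopsWith A X b l z) :
    z ∈ A ∨ ∃ c ∈ formed G l z, ∃ n, b c n = true := by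
  obtain ⟨n, rfl, h2, rfl, h4⟩ := h
  by_contra hcon
  push Not at hcon
  refine h4 (alive_succ.2 ⟨h2, hcon.1, fun c hc => ?_⟩)
  simpa using hcon.2 c hc (n + 1)

lemma StopsWith.adj {A : Finset V} {X : ℕ → V} {b : OrientedCycle G → ℕ → Bool}
    (hX : ∀ n, G.Adj (X n) (X (n + 1))) {l : List V} {z : V} (h : StopsWith A X b l z) :
    ∀ a ∈ (l ++ [z]).zip (l ++ [z]).tail, G.Adj a.1 a.2 := by
  obtain ⟨n, rfl, h2, rfl, h4⟩ := h
  exact loopErasure_adj hX n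

end Stopping

/-! ### Arcs of a path -/

section Zip

variable {V : Type u}

lemma zip_cons_append (a : V) (l : List V) (z : V) :
    (a :: l ++ [z]).zip (a :: l ++ [z]).tail =
      (a, (l ++ [z]).head (by simp)) :: (l ++ [z]).zip (l ++ [z]).tail := by
  cases l <;> simp

lemma map_fst_zip_tail (l : List V) (z : V) :
    ((l ++ [z]).zip (l ++ [z]).tail).map Prod.fst = l := by
  induction l with
  | nil => simp
  | cons a l ih => rw [zip_cons_append, List.map_cons, ih]

lemma fst_mem_of_mem_zip {l : List V} {z : V} {a : V × V}
    (h : a ∈ (l ++ [z]).zip (l ++ [z]).tail) : a.1 ∈ l := by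
  have := List.mem_map_of_mem (f := Prod.fst) h
  rwa [map_fst_zip_tail] at this

lemma snd_mem_of_mem_zip {l : List V} {z : V} {a : V × V}
    (h : a ∈ (l ++ [z]).zip (l ++ [z]).tail) : a.2 ∈ l ∨ a.2 = z := by
  have := List.mem_of_mem_tail (List.of_mem_zip (show (a.1, a.2) ∈ _ from h)).2
  simpa using this

lemma exists_mem_zip {l : List V} (z : V) {a : V} (h : a ∈ l) :
    ∃ b, (a, b) ∈ (l ++ [z]).zip (l ++ [z]).tail := by
  rw [← map_fst_zip_tail l z] at h
  obtain ⟨⟨a', b⟩, hb, rfl⟩ := List.mem_map.1 h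
  exact ⟨b, hb⟩

lemma zip_tail_nodup {l : List V} (hl : l.Nodup) (z : V) :
    ((l ++ [z]).zip (l ++ [z]).tail).Nodup :=
  List.Nodup.of_map Prod.fst (by rwa [map_fst_zip_tail])

lemma zip_tail_functional {l : List V} (hl : l.Nodup) {z a b b' : V}
    (h : (a, b) ∈ (l ++ [z]).zip (l ++ [z]).tail) (h' : (a, b') ∈ (l ++ [z]).zip (l ++ [z]).tail) :
    b = b' := by
  have hinj := List.inj_on_of_nodup_map (f := Prod.fst)
    (l := (l ++ [z]).zip (l ++ [z]).tail) (by rwa [map_fst_zip_tail])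
  exact congrArg Prod.snd (hinj h h' rfl)

lemma zip_append_right (l m : List V) (y z : V) :
    (l ++ y :: m ++ [z]).zip (l ++ y :: m ++ [z]).tail =
      (l ++ [y]).zip (l ++ [y]).tail ++ (y :: m ++ [z]).zip (y :: m ++ [z]).tail := by
  induction l with
  | nil => simp
  | cons a l ih =>
    have h1 : a :: l ++ y :: m ++ [z] = a :: (l ++ y :: m) ++ [z] := by simp
    rw [h1, zip_cons_append, ih, zip_cons_append]
    cases l <;> simp

end Zip

/-! ### Branches of a functional graph -/

section Functional

variable {V : Type u}

/-- The arc set `F` is the graph of `f`. -/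
def IsGraphOf (F : Finset (V × V)) (f : V → V) : Prop :=
  ∀ x y, (x, y) ∈ F ↔ f x = y

lemma IsOrientedCRSF.exists_isGraphOf {G : SimpleGraph V} {F : Finset (V × V)}
    (hF : IsOrientedCRSF G F) : ∃ f, IsGraphOf F f := by
  choose f hf hf' using hF.existsUnique_out
  exact ⟨f, fun x y => ⟨fun h => (hf' x y h).symm, fun h => h ▸ hf x⟩⟩

/-- Starting from `x`, the path `l` followed by the step to `z` runs along `F`, avoids `N`, and ends
upon reaching `N` or closing a cycle. -/
structure IsBranch (F : Finset (V × V)) (N : Finset V) (x : V) (l : List V) (z : V) : Prop where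
  nodup : l.Nodup
  notMem : ∀ a ∈ l, a ∉ N
  head : l.head? = some x
  arcs : ∀ a ∈ (l ++ [z]).zip (l ++ [z]).tail, a ∈ F
  closes : z ∈ N ∨ z ∈ l

variable {F : Finset (V × V)} {f : V → V}

lemma append_eq_iterate (hf : IsGraphOf F f) {l : List V} {x z : V} (hhead : l.head? = some x)
    (h : ∀ a ∈ (l ++ [z]).zip (l ++ [z]).tail, a ∈ F) :
    l ++ [z] = List.iterate f x (l.length + 1) := by
  induction l generalizing x with
  | nil => simp at hhead
  | cons a l ih =>
    obtain rfl : a = x := by simpa using hhead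
    rw [zip_cons_append] at h
    have h1 : f a = (l ++ [z]).head (by simp) := (hf _ _).1 (h _ List.mem_cons_self)
    have h2 := fun b hb => h b (List.mem_cons_of_mem _ hb)
    cases l with
    | nil => simp [List.iterate, h1]
    | cons b l =>
      have h1' : f a = b := by simpa using h1
      rw [List.cons_append, ih (x := f a) (by simp [h1']) h2]
      simp [List.iterate]

lemma IsBranch.getElem (hf : IsGraphOf F f) {N : Finset V} {x z : V} {l : List V}
    (h : IsBranch F N x l z) (i : ℕ) (hi : i < l.length) : l[i] = f^[i] x := by
  have h1 := append_eq_iterate hf h.head h.arcs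
  have h2 : (l ++ [z])[i]'(by simp; omega) = f^[i] x := by
    simp only [h1, List.getElem_iterate]
  rwa [List.getElem_append_left hi] at h2

lemma IsBranch.last (hf : IsGraphOf F f) {N : Finset V} {x z : V} {l : List V}
    (h : IsBranch F N x l z) : z = f^[l.length] x := by
  have h1 := append_eq_iterate hf h.head h.arcs
  have h2 : (l ++ [z])[l.length]'(by simp) = f^[l.length] x := by
    simp only [h1, List.getElem_iterate]
  simpa using h2

/-- Two branches from `x` are initial segments of the orbit of `x`, so the longer one would run
through the end of the shorter one, which lies in `N` or has been visited before. -/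
lemma IsBranch.not_length_lt (hf : IsGraphOf F f) {N : Finset V} {x z z' : V} {l l' : List V}
    (h : IsBranch F N x l z) (h' : IsBranch F N x l' z') : ¬ l.length < l'.length := by
  intro hlt
  have hz : l'[l.length] = z := by rw [h'.getElem hf, h.last hf]
  rcases h.closes with hN | hl
  · exact h'.notMem z (hz ▸ List.getElem_mem hlt) hN
  · obtain ⟨i, hi, hi'⟩ := List.getElem_of_mem hl
    have h1 : l'[i]'(hi.trans hlt) = l'[l.length] := by
      rw [hz, ← hi', h'.getElem hf, h.getElem hf]
    have := (h'.nodup.getElem_inj_iff).1 h1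
    omega

lemma IsBranch.unique (hf : IsGraphOf F f) {N : Finset V} {x z z' : V} {l l' : List V}
    (h : IsBranch F N x l z) (h' : IsBranch F N x l' z') : l = l' ∧ z = z' := by
  have hlen : l.length = l'.length :=
    le_antisymm (not_lt.1 (h'.not_length_lt hf h)) (not_lt.1 (h.not_length_lt hf h'))
  have h1 := append_eq_iterate hf h.head h.arcs
  rw [hlen, ← append_eq_iterate hf h'.head h'.arcs] at h1
  exact ⟨(List.append_inj' h1 rfl).1, by simpa using (List.append_inj' h1 rfl).2⟩

lemma iterate_zip (f : V → V) (x : V) (k : ℕ) :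
    ∀ a ∈ (List.iterate f x k ++ [f^[k] x]).zip (List.iterate f x k ++ [f^[k] x]).tail,
      f a.1 = a.2 := by
  induction k generalizing x with
  | zero => simp [List.iterate]
  | succ k ih =>
    intro a ha
    rw [List.iterate, Function.iterate_succ_apply, zip_cons_append] at ha
    rcases List.mem_cons.1 ha with rfl | ha
    · cases k <;> simp [List.iterate]
    · exact ih (f x) a ha

/-- The orbit of `x`, up to the first time that it enters `N` or meets its past. -/
lemma exists_isBranch [Finite V] (hf : IsGraphOf F f) {N : Finset V} {x : V} (hx : x ∉ N) :
    ∃ l z, IsBranch F N x l z := by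
  classical
  have hex : ∃ k, f^[k] x ∈ N ∨ ∃ i < k, f^[i] x = f^[k] x := by
    obtain ⟨i, j, hij, h⟩ := Finite.exists_ne_map_eq_of_infinite fun k : ℕ => f^[k] x
    rcases lt_or_gt_of_ne hij with hlt | hlt
    · exact ⟨j, Or.inr ⟨i, hlt, h⟩⟩
    · exact ⟨i, Or.inr ⟨j, hlt, h.symm⟩⟩
  obtain ⟨hk, hmin⟩ : (f^[Nat.find hex] x ∈ N ∨
      ∃ i < Nat.find hex, f^[i] x = f^[Nat.find hex] x) ∧ ∀ m < Nat.find hex,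
      ¬ (f^[m] x ∈ N ∨ ∃ i < m, f^[i] x = f^[m] x) :=
    ⟨Nat.find_spec hex, fun m => Nat.find_min hex⟩
  set k := Nat.find hex
  have hk0 : k ≠ 0 := by
    intro h0
    rw [h0] at hk
    rcases hk with hk | ⟨i, hi, _⟩
    · exact hx hk
    · omega
  refine ⟨List.iterate f x k, f^[k] x, ?_, ?_, ?_, ?_, ?_⟩
  · rw [List.nodup_iff_pairwise_ne, List.pairwise_iff_getElem]
    intro i j hi hj hij heq
    rw [List.length_iterate] at hi hj
    simp only [List.getElem_iterate] at heq
    exact hmin j hj (Or.inr ⟨i, hij, heq⟩)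
  · intro a ha haN
    obtain ⟨m, hm, rfl⟩ := List.mem_iterate.1 ha
    exact hmin m hm (Or.inl haN)
  · obtain ⟨k', hk'⟩ := Nat.exists_eq_succ_of_ne_zero hk0
    rw [hk']
    rfl
  · exact fun a ha => (hf a.1 a.2).2 (iterate_zip f x k a ha)
  · rcases hk with hk | ⟨i, hi, h⟩
    · exact Or.inl hk
    · exact Or.inr (List.mem_iterate.2 ⟨i, hi, h.symm⟩)

/-- A set stable under `f` that meets the path contains the end of the path. -/
lemma IsBranch.last_mem (hf : IsGraphOf F f) {N : Finset V} {x z v : V} {l : List V}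
    (h : IsBranch F N x l z) (hv : v ∈ l) {C : Set V} (hC : ∀ a ∈ C, f a ∈ C) (hvC : v ∈ C) :
    z ∈ C := by
  have hit : ∀ n, ∀ a ∈ C, f^[n] a ∈ C := by
    intro n
    induction n with
    | zero => exact fun a ha => ha
    | succ n ih => exact fun a ha => ih _ (hC a ha)
  obtain ⟨i, hi, rfl⟩ := List.getElem_of_mem hv
  rw [h.getElem hf] at hvC
  have := hit (l.length - i) _ hvC
  rwa [← Function.iterate_add_apply, Nat.sub_add_cancel hi.le, ← h.last hf] at this

lemma leads_iterate (hf : IsGraphOf F f) (x : V) (n : ℕ) : Leads F x (f^[n] x) := by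
  induction n with
  | zero => exact Relation.ReflTransGen.refl
  | succ n ih =>
    rw [Function.iterate_succ_apply']
    exact ih.tail ((hf _ _).2 rfl)

lemma IsBranch.leads (hf : IsGraphOf F f) {N : Finset V} {x z v : V} {l : List V}
    (h : IsBranch F N x l z) (hv : v ∈ l) : Leads F x v := by
  obtain ⟨i, hi, rfl⟩ := List.getElem_of_mem hv
  rw [h.getElem hf]
  exact leads_iterate hf x i

variable [DecidableEq V]

/-- The nodes `N` together with the arcs of `F` that leave them. -/
def outSubgraph (F : Finset (V × V)) (N : Finset V) : OrientedSubgraph V :=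
  ⟨N, F.filter fun a => a.1 ∈ N⟩

lemma IsBranch.image_mem (hf : IsGraphOf F f) {N : Finset V} (hN : ∀ a ∈ N, f a ∈ N) {x z : V}
    {l : List V} (h : IsBranch F N x l z) : ∀ a ∈ N ∪ l.toFinset, f a ∈ N ∪ l.toFinset := by
  intro a ha
  simp only [Finset.mem_union, List.mem_toFinset] at ha ⊢
  rcases ha with ha | ha
  · exact Or.inl (hN a ha)
  · obtain ⟨b, hb⟩ := exists_mem_zip z ha
    have hfb := (hf _ _).1 (h.arcs _ hb)
    rw [hfb]
    rcases snd_mem_of_mem_zip hb with h' | h'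
    · exact Or.inr h'
    · have h'' : b = z := h'
      rw [h'']
      exact h.closes

/-- The arcs that leave `N` or the branch are those leaving `N` and those of the branch. -/
lemma IsBranch.filter_eq (hf : IsGraphOf F f) {N : Finset V} {x z : V} {l : List V}
    (h : IsBranch F N x l z) :
    F.filter (fun a => a.1 ∈ N ∪ l.toFinset) =
      F.filter (fun a => a.1 ∈ N) ∪ ((l ++ [z]).zip (l ++ [z]).tail).toFinset := by
  ext ⟨a, b⟩
  simp only [Finset.mem_filter, Finset.mem_union, List.mem_toFinset]
  constructor
  · rintro ⟨hab, ha | ha⟩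
    · exact Or.inl ⟨hab, ha⟩
    · right
      obtain ⟨b', hb'⟩ := exists_mem_zip z ha
      rwa [← (hf _ _).1 hab, (hf _ _).1 (h.arcs _ hb')]
  · rintro (h' | h')
    · exact ⟨h'.1, Or.inl h'.2⟩
    · exact ⟨h.arcs _ h', Or.inr (fst_mem_of_mem_zip h')⟩

lemma IsBranch.union_ofPath (hf : IsGraphOf F f) {N : Finset V} {x z : V} {l : List V}
    (h : IsBranch F N x l z) :
    (outSubgraph F N).union (ofPath (l ++ [z])) = outSubgraph F (N ∪ l.toFinset) := by
  refine OrientedSubgraph.ext ?_ (h.filter_eq hf).symm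
  have hz := h.closes
  ext a
  simp only [OrientedSubgraph.union, outSubgraph, ofPath, Finset.mem_union, List.mem_toFinset,
    List.mem_append, List.mem_singleton]
  constructor
  · rintro (h' | h' | rfl)
    · exact Or.inl h'
    · exact Or.inr h'
    · exact hz
  · rintro (h' | h')
    · exact Or.inl h'
    · exact Or.inr (Or.inl h')

lemma IsBranch.union_trail [Fintype V] (hf : IsGraphOf F f) {N : Finset V}
    (hN : ∀ a ∈ N, f a ∈ N) {x z : V} {l : List V} (h : IsBranch F N x l z) :
    (outSubgraph F N).union (trail F x) = outSubgraph F (N ∪ l.toFinset) := by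
  have hlead : ∀ a, Leads F x a → a ∈ N ∪ l.toFinset := by
    intro a ha
    induction ha with
    | refl =>
      exact Finset.mem_union_right _ (List.mem_toFinset.2 (List.mem_of_mem_head? h.head))
    | tail _ hbc ih =>
      rw [← (hf _ _).1 hbc]
      exact h.image_mem hf hN _ ih
  have hmem : ∀ a, a ∈ N ∨ Leads F x a ↔ a ∈ N ∪ l.toFinset := by
    intro a
    constructor
    · rintro (ha | ha)
      · exact Finset.mem_union_left _ ha
      · exact hlead a ha
    · intro ha
      rcases Finset.mem_union.1 ha with ha | ha
      · exact Or.inl ha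
      · exact Or.inr (h.leads hf (List.mem_toFinset.1 ha))
  refine OrientedSubgraph.ext ?_ ?_
  · ext a
    rw [show a ∈ (outSubgraph F (N ∪ l.toFinset)).nodes ↔ a ∈ N ∪ l.toFinset from Iff.rfl, ← hmem]
    simp [OrientedSubgraph.union, outSubgraph, trail]
  · ext a
    simp only [OrientedSubgraph.union, outSubgraph, trail, Finset.mem_union, Finset.mem_filter]
    rw [← Finset.mem_union, ← hmem, ← and_or_left]

/-! ### Cycles of a functional graph -/

variable {G : SimpleGraph V}

/-- A cycle of `F` read from one of its nodes. -/
lemma OrientedCycle.IsIn.exists_isBranch {c : OrientedCycle G} {F : Finset (V × V)} (h : c.IsIn F)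
    {v : V} (hv : v ∈ c.1) : ∃ m, c.1 = (v :: m : List V) ∧ IsBranch F ∅ v (v :: m) v := by
  obtain ⟨c, h1, h2, h3⟩ := c
  induction c using Quotient.inductionOn' with
  | h l =>
    obtain ⟨l₁, l₂, rfl⟩ := List.append_of_mem (show v ∈ l from hv)
    have hrot : (Quotient.mk'' (l₁ ++ v :: l₂) : Cycle V) = ((v :: (l₂ ++ l₁) : List V) : Cycle V) :=
      Cycle.coe_eq_coe.2 ⟨l₁.length, by rw [List.rotate_append_length_eq]; simp⟩
    refine ⟨l₂ ++ l₁, hrot, ?_, by simp, rfl, ?_, Or.inr (by simp)⟩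
    · rw [hrot] at h1
      exact h1
    · intro a ha
      refine h a ?_
      change a ∈ cycleArcs (Quotient.mk'' (l₁ ++ v :: l₂))
      rw [hrot, cycleArcs_coe, ← closed_zip]
      exact ha

lemma isIn_of_coe {c : OrientedCycle G} {F : Finset (V × V)} {v : V} {m : List V}
    (hc : c.1 = (v :: m : List V))
    (h : ∀ a ∈ (v :: m ++ [v]).zip (v :: m ++ [v]).tail, a ∈ F) : c.IsIn F := by
  intro a ha
  refine h a ?_
  rw [closed_zip]
  have : c.arcs = cycleArcs (v :: m : List V) := congrArg cycleArcs hc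
  rw [this, cycleArcs_coe] at ha
  exact ha

lemma OrientedCycle.IsIn.image_mem {c : OrientedCycle G} (h : c.IsIn F) (hf : IsGraphOf F f) :
    ∀ v ∈ c.1, f v ∈ c.1 := by
  intro v hv
  obtain ⟨m, hm, hb⟩ := h.exists_isBranch hv
  obtain ⟨w, hw⟩ := exists_mem_zip v (List.mem_cons_self (a := v) (l := m))
  rw [(hf _ _).1 (hb.arcs _ hw), hm]
  rcases snd_mem_of_mem_zip hw with h' | h'
  · exact h'
  · have h'' : w = v := h'
    rw [h'']
    exact List.mem_cons_self

lemma OrientedCycle.IsIn.unique {c c' : OrientedCycle G} (h : c.IsIn F) (h' : c'.IsIn F)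
    (hf : IsGraphOf F f) {v : V} (hv : v ∈ c.1) (hv' : v ∈ c'.1) : c = c' := by
  obtain ⟨m, hm, hb⟩ := h.exists_isBranch hv
  obtain ⟨m', hm', hb'⟩ := h'.exists_isBranch hv'
  have := (hb.unique hf hb').1
  exact Subtype.ext (by rw [hm, hm', this])

lemma OrientedCycle.exists_mem (c : OrientedCycle G) : ∃ v, v ∈ c.1 := by
  obtain ⟨c, h1, h2, h3⟩ := c
  induction c using Quotient.inductionOn' with
  | h l =>
    cases l with
    | nil => exact absurd (show 2 ≤ 0 from h2) (by decide)
    | cons a l => exact ⟨a, List.mem_cons_self⟩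

/-- The last arc of a branch either joins the previous nodes or closes one cycle; adding the branch
multiplies the weight by those of its arcs and of this cycle. -/
lemma IsBranch.forestWeight_eq [Fintype V] (W : EdgeWeights G) (φ : Connection G)
    (hf : IsGraphOf F f) {N : Finset V} (hN : ∀ a ∈ N, f a ∈ N) {x z : V} {l : List V}
    (h : IsBranch F N x l z) :
    forestWeight W φ (outSubgraph F (N ∪ l.toFinset)).arcs =
      forestWeight W φ (outSubgraph F N).arcs *
        ((arcsProd W.w (l ++ [z]) * ∏ c ∈ formed G l z, alpha φ c : ℝ) : ℂ) := by
  classical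
  have harcs := h.filter_eq hf
  have hdisj : Disjoint (F.filter fun a => a.1 ∈ N)
      ((l ++ [z]).zip (l ++ [z]).tail).toFinset := by
    rw [Finset.disjoint_left]
    intro a ha ha'
    exact h.notMem _ (fst_mem_of_mem_zip (List.mem_toFinset.1 ha')) (Finset.mem_filter.1 ha).2
  have hsub : ∀ {S : Finset V} {c : OrientedCycle G}, c.IsIn (F.filter fun a => a.1 ∈ S) →
      c.IsIn F := fun hc a ha => (Finset.mem_filter.1 (hc a ha)).1
  have htail : ∀ {S : Finset V} {c : OrientedCycle G}, c.IsIn (F.filter fun a => a.1 ∈ S) →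
      ∀ v ∈ c.1, v ∈ S := by
    intro S c hc v hv
    obtain ⟨m, hm, hb⟩ := hc.exists_isBranch hv
    obtain ⟨w, hw⟩ := exists_mem_zip v (List.mem_cons_self (a := v) (l := m))
    exact (Finset.mem_filter.1 (hb.arcs _ hw)).2
  have hcycle : ∀ {c : OrientedCycle G}, c ∈ formed G l z → z ∈ c.1 ∧ z ∈ l ∧ c.IsIn
      (F.filter fun a => a.1 ∈ N ∪ l.toFinset) := by
    intro c hc
    have hzl : z ∈ l := by
      by_contra hzl
      rw [formed_eq_empty hzl] at hc
      simp at hc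
    obtain ⟨m, hm, hm'⟩ := eq_takeWhile_append l z hzl
    rw [mem_formed, hm'] at hc
    refine ⟨by rw [hc]; exact List.mem_cons_self, hzl, isIn_of_coe hc fun a ha => ?_⟩
    rw [harcs]
    refine Finset.mem_union_right _ (List.mem_toFinset.2 ?_)
    rw [hm, zip_append_right]
    exact List.mem_append_right _ ha
  have hcycles : (Finset.univ.filter fun c : OrientedCycle G => c.IsIn
      (F.filter fun a => a.1 ∈ N ∪ l.toFinset)) =
      (Finset.univ.filter fun c : OrientedCycle G => c.IsIn (F.filter fun a => a.1 ∈ N)) ∪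
        formed G l z := by
    ext c
    rw [Finset.mem_union, Finset.mem_filter_univ, Finset.mem_filter_univ]
    constructor
    · intro hc
      by_cases hcN : ∀ v ∈ c.1, v ∈ N
      · left
        intro a ha
        refine Finset.mem_filter.2 ⟨hsub hc a ha, ?_⟩
        refine hcN _ ?_
        obtain ⟨c, h1, h2, h3⟩ := c
        induction c using Quotient.inductionOn' with
        | h l => exact (List.of_mem_zip (show (a.1, a.2) ∈ l.zip (l.rotate 1) from ha)).1
      · right
        push Not at hcN
        obtain ⟨v, hv, hvN⟩ := hcN
        have hvl : v ∈ l := by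
          have := htail hc v hv
          simp only [Finset.mem_union, List.mem_toFinset] at this
          exact this.resolve_left hvN
        -- a cycle that meets the branch contains its end `z`; since `N` is stable under `f`, this
        -- excludes `z ∈ N`, and otherwise the cycle is the one closed by the step to `z`
        have hzc : z ∈ c.1 := h.last_mem hf hvl (C := {v | v ∈ c.1}) ((hsub hc).image_mem hf) hv
        obtain ⟨m, hm, hb⟩ := (hsub hc).exists_isBranch hzc
        rcases h.closes with hz | hz
        · exfalso
          have hv' : v ∈ z :: m := by rw [hm] at hv; exact hv
          obtain ⟨i, hi, hi'⟩ := List.getElem_of_mem hv'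
          rw [hb.getElem hf] at hi'
          have : ∀ n, f^[n] z ∈ N := by
            intro n
            induction n with
            | zero => exact hz
            | succ n ih => rw [Function.iterate_succ_apply']; exact hN _ ih
          exact hvN (hi' ▸ this i)
        · obtain ⟨m', hm', hd⟩ := eq_takeWhile_append l z hz
          have hnd := h.nodup
          rw [hm', List.nodup_append] at hnd
          have hb' : IsBranch F ∅ z (z :: m') z := by
            refine ⟨hnd.2.1, by simp, rfl, fun a ha => h.arcs a ?_, Or.inr (by simp)⟩
            rw [hm', zip_append_right]
            exact List.mem_append_right _ ha
          rw [mem_formed, hd, hm, (hb.unique hf hb').1]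
    · rintro (hc | hc)
      · intro a ha
        have := Finset.mem_filter.1 (hc a ha)
        exact Finset.mem_filter.2 ⟨this.1, Finset.mem_union_left _ this.2⟩
      · exact (hcycle hc).2.2
  have hdisj' : Disjoint
      (Finset.univ.filter fun c : OrientedCycle G => c.IsIn (F.filter fun a => a.1 ∈ N))
      (formed G l z) := by
    rw [Finset.disjoint_left]
    intro c hc hc'
    exact h.notMem z (hcycle hc').2.1
      (htail (Finset.mem_filter.1 hc).2 z (hcycle hc').1)
  have hprod : (∏ a ∈ ((l ++ [z]).zip (l ++ [z]).tail).toFinset, (W.w a.1 a.2 : ℂ)) =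
      (arcsProd W.w (l ++ [z]) : ℝ) := by
    rw [List.prod_toFinset _ (zip_tail_nodup h.nodup z)]
    exact (map_arcsProd W.w Complex.ofRealHom.toMonoidHom (l ++ [z])).symm
  have hw : ∀ F' : Finset (V × V), forestWeight W φ F' = (∏ a ∈ F', (W.w a.1 a.2 : ℂ)) *
    ∏ c ∈ Finset.univ.filter (fun c : OrientedCycle G => c.IsIn F'), ((alpha φ c : ℝ) : ℂ) := by
    intro F'
    unfold forestWeight alpha
    congr!
  rw [hw, hw]
  change (∏ a ∈ F.filter (fun a => a.1 ∈ N ∪ l.toFinset), (W.w a.1 a.2 : ℂ)) *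
    (∏ c ∈ Finset.univ.filter (fun c : OrientedCycle G => c.IsIn
      (F.filter fun a => a.1 ∈ N ∪ l.toFinset)), ((alpha φ c : ℝ) : ℂ)) =
    ((∏ a ∈ F.filter (fun a => a.1 ∈ N), (W.w a.1 a.2 : ℂ)) *
    (∏ c ∈ Finset.univ.filter (fun c : OrientedCycle G => c.IsIn
      (F.filter fun a => a.1 ∈ N)), ((alpha φ c : ℝ) : ℂ))) * _
  rw [hcycles, harcs, Finset.prod_union hdisj, Finset.prod_union hdisj', hprod]
  push_cast
  ring

end Functional

/-! ### Functional graphs are oriented cycle-rooted spanning forests -/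

section CRSF

variable {V : Type u} {G : SimpleGraph V} {F : Finset (V × V)} {f : V → V}

lemma sameComponent_iterate (hf : IsGraphOf F f) (hadj : ∀ a ∈ F, G.Adj a.1 a.2) (x : V) (n : ℕ) :
    SameComponent F x (f^[n] x) := by
  induction n with
  | zero => exact SimpleGraph.Reachable.refl x
  | succ n ih =>
    rw [Function.iterate_succ_apply']
    have hmem : (f^[n] x, f (f^[n] x)) ∈ F := (hf _ _).2 rfl
    refine SimpleGraph.Reachable.trans ih (SimpleGraph.Adj.reachable ?_)
    rw [SimpleGraph.fromRel_adj]
    exact ⟨(hadj _ hmem).ne, Or.inl hmem⟩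

lemma SameComponent.exists_iterate (hf : IsGraphOf F f) {x y : V} (h : SameComponent F x y) :
    ∃ m n, f^[m] x = f^[n] y := by
  obtain ⟨p⟩ := h
  induction p with
  | nil => exact ⟨0, 0, rfl⟩
  | @cons x w y hxw p ih =>
    obtain ⟨m, n, hmn⟩ := ih
    rw [SimpleGraph.fromRel_adj] at hxw
    rcases hxw.2 with h' | h'
    · refine ⟨m + 1, n, ?_⟩
      rw [Function.iterate_succ_apply, (hf _ _).1 h', hmn]
    · refine ⟨m, n + 1, ?_⟩
      rw [Function.iterate_succ_apply', ← hmn, ← Function.iterate_succ_apply' f,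
        Function.iterate_succ_apply, (hf _ _).1 h']

variable [DecidableEq V]

lemma OrientedCycle.IsIn.iterate_mem {c : OrientedCycle G} (h : c.IsIn F) (hf : IsGraphOf F f)
    {v : V} (hv : v ∈ c.1) (n : ℕ) : f^[n] v ∈ c.1 := by
  induction n with
  | zero => exact hv
  | succ n ih =>
    rw [Function.iterate_succ_apply']
    exact h.image_mem hf _ ih

lemma isOrientedCRSF_of_isGraphOf [Finite V] (hf : IsGraphOf F f)
    (hadj : ∀ a ∈ F, G.Adj a.1 a.2) (hasymm : ∀ x y, (x, y) ∈ F → (y, x) ∉ F) :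
    IsOrientedCRSF G F where
  adj := hadj
  asymm := hasymm
  existsUnique_out x := ⟨f x, (hf _ _).2 rfl, fun y hy => ((hf _ _).1 hy).symm⟩
  existsUnique_cycle x := by
    obtain ⟨l, z, h⟩ := exists_isBranch hf (Finset.notMem_empty x)
    have hz : z ∈ l := h.closes.resolve_left (Finset.notMem_empty z)
    obtain ⟨m, hm, -⟩ := eq_takeWhile_append l z hz
    set l₁ := l.takeWhile fun a => decide (a ≠ z)
    have harcs : ∀ a ∈ (z :: m ++ [z]).zip (z :: m ++ [z]).tail, a ∈ F := by
      intro a ha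
      refine h.arcs a ?_
      rw [hm, zip_append_right]
      exact List.mem_append_right _ ha
    have hnd := h.nodup
    rw [hm, List.nodup_append] at hnd
    obtain ⟨c, hc⟩ := exists_orientedCycle (G := G) hnd.2.1 fun a ha => hadj a (harcs a ha)
    have hcF : c.IsIn F := isIn_of_coe hc harcs
    refine ⟨c, ⟨hcF, fun v hv => ?_⟩, ?_⟩
    · rw [hc] at hv
      have hvl : v ∈ l := by
        rw [hm]
        exact List.mem_append_right _ hv
      obtain ⟨i, hi, rfl⟩ := List.getElem_of_mem hvl
      rw [h.getElem hf]
      exact sameComponent_iterate hf hadj x i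
    · rintro c' ⟨hc'F, hc'⟩
      obtain ⟨v, hv⟩ := c'.exists_mem
      obtain ⟨i, j, hij⟩ := (hc' v hv).exists_iterate hf
      have hzc : z ∈ c.1 := by rw [hc]; exact List.mem_cons_self
      have hxz := h.last hf
      -- both cycles contain a common iterate of `x`
      refine hc'F.unique hcF hf (v := f^[l.length + i] x) ?_ ?_
      · rw [Function.iterate_add_apply, hij, ← Function.iterate_add_apply]
        exact hc'F.iterate_mem hf hv _
      · rw [add_comm, Function.iterate_add_apply, ← hxz]
        exact hcF.iterate_mem hf hzc _
  toward x c hc hx := by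
    obtain ⟨v, hv⟩ := c.exists_mem
    obtain ⟨i, j, hij⟩ := (hx v hv).exists_iterate hf
    exact ⟨f^[i] x, hij ▸ hc.iterate_mem hf hv j, leads_iterate hf x i⟩

end CRSF

/-! ### Stages of a forest -/

section Stages

variable {V : Type u} [Fintype V] [DecidableEq V] (ι : Fin (Fintype.card V) ≃ V)

lemma firstMissing_eq_some {S : Finset V} {x : V} (h : firstMissing ι S = some x) : x ∉ S := by
  simpa using List.find?_some h

lemma firstMissing_eq_none {S : Finset V} : firstMissing ι S = none ↔ S = Finset.univ := by
  unfold firstMissing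
  rw [List.find?_eq_none, Finset.eq_univ_iff_forall]
  constructor
  · intro h x
    simpa using h x (List.mem_map.2 ⟨ι.symm x, List.mem_finRange _, by simp⟩)
  · intro h x _
    simpa using h x

lemma exists_firstMissing {S : Finset V} (h : S ≠ Finset.univ) : ∃ x, firstMissing ι S = some x :=
  Option.ne_none_iff_exists'.1 fun h' => h ((firstMissing_eq_none ι).1 h')

variable {F : Finset (V × V)} {f : V → V}

lemma stage_succ {l : ℕ} {x : V} (h : firstMissing ι (stage ι F l).nodes = some x) :
    stage ι F (l + 1) = (stage ι F l).union (trail F x) := by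
  rw [stage, h]

/-- Each stage consists of a set of nodes stable under `f` and of the arcs that leave it. -/
lemma stage_spec (hf : IsGraphOf F f) (l : ℕ) :
    stage ι F l = outSubgraph F (stage ι F l).nodes ∧
      ∀ a ∈ (stage ι F l).nodes, f a ∈ (stage ι F l).nodes := by
  induction l with
  | zero => simp [stage, OrientedSubgraph.empty, outSubgraph]
  | succ l ih =>
    cases h : firstMissing ι (stage ι F l).nodes with
    | none =>
      have : stage ι F (l + 1) = stage ι F l := by rw [stage, h]
      rw [this]
      exact ih
    | some x =>
      obtain ⟨p, z, hb⟩ := exists_isBranch hf (firstMissing_eq_some ι h)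
      have hs := stage_succ ι h
      rw [ih.1, hb.union_trail hf ih.2] at hs
      rw [hs]
      exact ⟨rfl, hb.image_mem hf ih.2⟩

lemma stage_eq (hf : IsGraphOf F f) (l : ℕ) : stage ι F l = outSubgraph F (stage ι F l).nodes :=
  (stage_spec ι hf l).1

lemma stage_image_mem (hf : IsGraphOf F f) (l : ℕ) :
    ∀ a ∈ (stage ι F l).nodes, f a ∈ (stage ι F l).nodes :=
  (stage_spec ι hf l).2

lemma stage_succ_eq (hf : IsGraphOf F f) {l : ℕ} {x z : V} {p : List V}
    (hx : firstMissing ι (stage ι F l).nodes = some x)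
    (hb : IsBranch F (stage ι F l).nodes x p z) :
    stage ι F (l + 1) = outSubgraph F ((stage ι F l).nodes ∪ p.toFinset) := by
  rw [stage_succ ι hx, stage_eq ι hf l]
  exact hb.union_trail hf (stage_image_mem ι hf l)

lemma stage_mono (F : Finset (V × V)) {k l : ℕ} (h : k ≤ l) :
    (stage ι F k).nodes ⊆ (stage ι F l).nodes := by
  induction l, h using Nat.le_induction with
  | base => exact subset_rfl
  | succ l _ ih =>
    refine ih.trans ?_
    rw [stage]
    split
    · exact subset_rfl
    · exact Finset.subset_union_left

lemma mem_stage_succ {l : ℕ} {x : V} (h : firstMissing ι (stage ι F l).nodes = some x) :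
    x ∈ (stage ι F (l + 1)).nodes := by
  rw [stage_succ ι h]
  refine Finset.mem_union_right _ ?_
  simp only [trail, Finset.mem_filter, Finset.mem_univ, true_and]
  exact Relation.ReflTransGen.refl

lemma exists_stage_eq_univ (F : Finset (V × V)) : ∃ l, (stage ι F l).nodes = Finset.univ := by
  by_contra hcon
  push Not at hcon
  have hcard : ∀ l, l ≤ (stage ι F l).nodes.card := by
    intro l
    induction l with
    | zero => exact Nat.zero_le _
    | succ l ih =>
      obtain ⟨x, hx⟩ := exists_firstMissing ι (hcon l)
      refine lt_of_le_of_lt ih (Finset.card_lt_card ?_)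
      exact (Finset.ssubset_iff_of_subset (stage_mono ι F l.le_succ)).2
        ⟨x, mem_stage_succ ι hx, firstMissing_eq_some ι hx⟩
  have := (hcard (Fintype.card V + 1)).trans (Finset.card_le_univ _)
  omega

lemma stage_numStages (F : Finset (V × V)) : (stage ι F (numStages ι F)).nodes = Finset.univ :=
  Nat.sInf_mem (s := {l | (stage ι F l).nodes = Finset.univ}) (exists_stage_eq_univ ι F)

lemma exists_firstMissing_stage {F : Finset (V × V)} {l : ℕ} (h : l < numStages ι F) :
    ∃ x, firstMissing ι (stage ι F l).nodes = some x :=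
  exists_firstMissing ι (Nat.notMem_of_lt_sInf h)

lemma stage_numStages_eq (hf : IsGraphOf F f) :
    stage ι F (numStages ι F) = ⟨Finset.univ, F⟩ := by
  rw [stage_eq ι hf, stage_numStages]
  simp [outSubgraph]

end Stages

/-! ### Runs of the algorithm -/

section Run

variable {V : Type u} [Fintype V] [DecidableEq V] {G : SimpleGraph V}
  {ι : Fin (Fintype.card V) ≃ V} {X : V → ℕ → V} {b : V → OrientedCycle G → ℕ → Bool}

lemma run_succ_eq_some (h0 : ∀ x, X x 0 = x) {l : ℕ} {T : OrientedSubgraph V} :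
    run ι X b (l + 1) = some T ↔ ∃ T' x p z, run ι X b l = some T' ∧
      firstMissing ι T'.nodes = some x ∧ StopsWith T'.nodes (X x) (b x) p z ∧
      T = T'.union (ofPath (p ++ [z])) := by
  simp only [run, Option.bind_eq_some_iff, Option.map_eq_some_iff]
  constructor
  · rintro ⟨T', hT', x, hx, J, hJ, rfl⟩
    obtain ⟨p, z, hs, rfl⟩ := exists_stopsWith_of_branch
      (by rw [h0]; exact firstMissing_eq_some ι hx) hJ
    exact ⟨T', x, p, z, hT', hx, hs, rfl⟩
  · rintro ⟨T', x, p, z, hT', hx, hs, rfl⟩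
    exact ⟨T', hT', x, hx, _, hs.branch_eq, rfl⟩

variable {F : Finset (V × V)} {f : V → V}

lemma StopsWith.isBranch {A : Finset V} {Y : ℕ → V} {b : OrientedCycle G → ℕ → Bool} {p : List V}
    {x z : V} (h : StopsWith A Y b p z) (h0 : Y 0 = x)
    (hF : ∀ a ∈ (p ++ [z]).zip (p ++ [z]).tail, a ∈ F) : IsBranch F A x p z where
  nodup := (CyclePopping.mem_paths.1 h.mem_paths).1
  notMem := (CyclePopping.mem_paths.1 h.mem_paths).2
  head := h0 ▸ h.head
  arcs := hF
  closes := by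
    refine h.mem_or_accepted.imp_right ?_
    rintro ⟨c, hc, -⟩
    by_contra hz
    rw [formed_eq_empty hz] at hc
    simp at hc

/-- As long as the run stays inside `F`, it goes through the stages of `F`. -/
lemma run_eq_stage (hf : IsGraphOf F f) (h0 : ∀ x, X x 0 = x) {l : ℕ} {T : OrientedSubgraph V}
    (h : run ι X b l = some T) (hT : T.arcs ⊆ F) :
    T = stage ι F l ∧ ∀ j ≤ l, run ι X b j = some (stage ι F j) := by
  induction l generalizing T with
  | zero =>
    have hT0 : T = stage ι F 0 := (Option.some_inj.1 h).symm
    refine ⟨hT0, fun j hj => ?_⟩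
    obtain rfl := Nat.le_zero.1 hj
    rw [h, hT0]
  | succ l ih =>
    obtain ⟨T', x, p, z, hT', hx, hs, rfl⟩ := (run_succ_eq_some h0).1 h
    obtain ⟨rfl, ih2⟩ := ih hT' (Finset.union_subset_left hT)
    have hb : IsBranch F (stage ι F l).nodes x p z := by
      refine hs.isBranch (h0 x) fun a ha => hT (Finset.mem_union_right _ ?_)
      exact List.mem_toFinset.2 ha
    have heq : (stage ι F l).union (ofPath (p ++ [z])) = stage ι F (l + 1) := by
      rw [stage_succ_eq ι hf hx hb, ← hb.union_ofPath hf]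
      exact congrArg (fun S => OrientedSubgraph.union S _) (stage_eq ι hf l)
    refine ⟨heq, fun j hj => ?_⟩
    rcases Nat.le_succ_iff.1 hj with hj | rfl
    · exact ih2 j hj
    · rw [h, heq]

lemma stage_arcs_subset (hf : IsGraphOf F f) (l : ℕ) : (stage ι F l).arcs ⊆ F := by
  rw [stage_eq ι hf]
  exact Finset.filter_subset _ _

lemma run_eq_stage_iff_forall (hf : IsGraphOf F f) (h0 : ∀ x, X x 0 = x) (l : ℕ) :
    run ι X b l = some (stage ι F l) ↔ ∀ j, 1 ≤ j → j ≤ l → run ι X b j = some (stage ι F j) := by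
  constructor
  · intro h j _ hj
    exact (run_eq_stage hf h0 h (stage_arcs_subset hf l)).2 j hj
  · intro h
    rcases Nat.eq_zero_or_pos l with rfl | hl
    · rfl
    · exact h l hl le_rfl

/-- The run follows the stages of `F` when each walk leaves the prescribed branch. -/
lemma run_eq_stage_iff_stopsWith (hf : IsGraphOf F f) (h0 : ∀ x, X x 0 = x) {x z : ℕ → V}
    {p : ℕ → List V} {l : ℕ} (hx : ∀ j < l, firstMissing ι (stage ι F j).nodes = some (x j))
    (hb : ∀ j < l, IsBranch F (stage ι F j).nodes (x j) (p j) (z j)) :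
    run ι X b l = some (stage ι F l) ↔
      ∀ j < l, StopsWith (stage ι F j).nodes (X (x j)) (b (x j)) (p j) (z j) := by
  induction l with
  | zero => simp [run, stage]
  | succ l ih =>
    specialize ih (fun j hj => hx j (hj.trans l.lt_succ_self))
      (fun j hj => hb j (hj.trans l.lt_succ_self))
    constructor
    · intro h
      have hl := (run_eq_stage hf h0 h (stage_arcs_subset hf _)).2 l l.le_succ
      obtain ⟨T', x', p', z', hT', hx', hs, hT⟩ := (run_succ_eq_some h0).1 h
      rw [hl, Option.some_inj] at hT'
      subst hT'
      rw [hx l l.lt_succ_self, Option.some_inj] at hx'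
      subst hx'
      have hb' : IsBranch F (stage ι F l).nodes (x l) p' z' := by
        refine hs.isBranch (h0 _) fun a ha => stage_arcs_subset (ι := ι) hf (l + 1) ?_
        rw [hT]
        exact Finset.mem_union_right _ (List.mem_toFinset.2 ha)
      obtain ⟨rfl, rfl⟩ := hb'.unique hf (hb l l.lt_succ_self)
      intro j hj
      rcases Nat.lt_succ_iff_lt_or_eq.1 hj with hj | rfl
      · exact ih.1 hl j hj
      · exact hs
    · intro h
      rw [run_succ_eq_some h0]
      refine ⟨_, _, _, _, ih.2 fun j hj => h j (hj.trans l.lt_succ_self), hx l l.lt_succ_self,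
        h l l.lt_succ_self, ?_⟩
      rw [stage_succ_eq ι hf (hx l l.lt_succ_self) (hb l l.lt_succ_self),
        ← (hb l l.lt_succ_self).union_ofPath hf]
      exact congrArg (fun S => OrientedSubgraph.union S _) (stage_eq ι hf l).symm

lemma returns_iff (hf : IsGraphOf F f) (h0 : ∀ x, X x 0 = x) :
    Returns ι X b F ↔ run ι X b (numStages ι F) = some (stage ι F (numStages ι F)) := by
  constructor
  · rintro ⟨l, hl⟩
    obtain ⟨h1, h2⟩ := run_eq_stage hf h0 hl (subset_refl F)
    refine h2 _ ?_
    exact Nat.sInf_le (by rw [Set.mem_ofPred_eq, ← h1])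
  · intro h
    exact ⟨_, h.trans (congrArg some (stage_numStages_eq ι hf))⟩

/-! ### The output of a run -/

/-- The property shared by the subgraphs that the algorithm builds: each node has one outgoing arc,
which ends in the subgraph, and no edge carries both orientations. -/
structure IsPartialForest (G : SimpleGraph V) (T : OrientedSubgraph V) : Prop where
  fst_mem : ∀ a ∈ T.arcs, a.1 ∈ T.nodes
  snd_mem : ∀ a ∈ T.arcs, a.2 ∈ T.nodes
  existsUnique_out : ∀ x ∈ T.nodes, ∃! y, (x, y) ∈ T.arcs
  adj : ∀ a ∈ T.arcs, G.Adj a.1 a.2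
  asymm : ∀ x y, (x, y) ∈ T.arcs → (y, x) ∉ T.arcs

/-- A backtrack has trivial holonomy, so it is never accepted. -/
lemma alpha_backtrack (φ : Connection G) {c : OrientedCycle G} {x y : V}
    (hc : c.1 = ([x, y] : List V)) : alpha φ c = 0 := by
  have hxy : G.Adj x y := by
    refine c.2.2.2 (x, y) ?_
    rw [hc, cycleArcs_coe]
    simp
  have hhol : hol φ c = 1 := by
    rw [hol_eq_arcsProd φ c hc]
    simp [φ.inv x y hxy]
  simp [alpha, theta, hhol]

/-- A self-avoiding path followed by one step runs through an edge in both directions only if its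
last step closes a backtrack. -/
lemma zip_asymm {p : List V} {z a b : V} (hp : p.Nodup)
    (hne : ∀ a ∈ (p ++ [z]).zip (p ++ [z]).tail, a.1 ≠ a.2)
    (h1 : (a, b) ∈ (p ++ [z]).zip (p ++ [z]).tail) (h2 : (b, a) ∈ (p ++ [z]).zip (p ++ [z]).tail) :
    ∃ q w, p = q ++ [z, w] := by
  induction p with
  | nil => simp at h1
  | cons c p ih =>
    rw [zip_cons_append] at h1 h2 hne
    have hcp : c ∉ p := (List.nodup_cons.1 hp).1
    rcases List.mem_cons.1 h1 with h1' | h1' <;> rcases List.mem_cons.1 h2 with h2' | h2'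
    · exact absurd ((Prod.mk.inj h1').1.trans (Prod.mk.inj h2').1.symm) (hne _ h1)
    · obtain ⟨rfl, hb⟩ := Prod.mk.injEq _ _ _ _ ▸ h1'
      have haz : a = z := (snd_mem_of_mem_zip h2').resolve_left hcp
      subst haz
      cases p with
      | nil => simp at h2'
      | cons d p =>
        have hbd : b = d := by simpa using hb
        subst hbd
        cases p with
        | nil => exact ⟨[], b, by simp⟩
        | cons e p =>
          exfalso
          rw [zip_cons_append] at h2'
          rcases List.mem_cons.1 h2' with h3 | h3
          · have : a = e := by simpa using h3
            exact hcp (by simp [this])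
          · exact (List.nodup_cons.1 (List.nodup_cons.1 hp).2).1 (fst_mem_of_mem_zip h3)
    · obtain ⟨rfl, hb⟩ := Prod.mk.injEq _ _ _ _ ▸ h2'
      have haz : b = z := (snd_mem_of_mem_zip h1').resolve_left hcp
      subst haz
      cases p with
      | nil => simp at h1'
      | cons d p =>
        have hbd : a = d := by simpa using hb
        subst hbd
        cases p with
        | nil => exact ⟨[], a, by simp⟩
        | cons e p =>
          exfalso
          rw [zip_cons_append] at h1'
          rcases List.mem_cons.1 h1' with h3 | h3
          · have : b = e := by simpa using h3
            exact hcp (by simp [this])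
          · exact (List.nodup_cons.1 (List.nodup_cons.1 hp).2).1 (fst_mem_of_mem_zip h3)
    · obtain ⟨q, w, hq⟩ := ih (List.nodup_cons.1 hp).2
        (fun a ha => hne a (List.mem_cons_of_mem _ ha)) h1' h2'
      exact ⟨c :: q, w, by rw [hq]; rfl⟩

lemma IsPartialForest.union {T : OrientedSubgraph V} (hT : IsPartialForest G T) (φ : Connection G)
    {Y : ℕ → V} {b : OrientedCycle G → ℕ → Bool} {p : List V} {z : V}
    (hs : StopsWith T.nodes Y b p z) (hY : ∀ n, G.Adj (Y n) (Y (n + 1)))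
    (hb : ∀ c n, alpha φ c = 0 → b c n = false) :
    IsPartialForest G (T.union (ofPath (p ++ [z]))) := by
  obtain ⟨hnd, hpT⟩ := mem_paths.1 hs.mem_paths
  have hadj := hs.adj hY
  have hmem : ∀ a, a ∈ (T.union (ofPath (p ++ [z]))).arcs ↔
      a ∈ T.arcs ∨ a ∈ (p ++ [z]).zip (p ++ [z]).tail := by
    intro a
    simp [OrientedSubgraph.union, ofPath]
  have hnodes : ∀ a, a ∈ (T.union (ofPath (p ++ [z]))).nodes ↔
      a ∈ T.nodes ∨ a ∈ p ∨ a = z := by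
    intro a
    simp only [OrientedSubgraph.union, ofPath, Finset.mem_union, List.mem_toFinset,
      List.mem_append, List.mem_singleton]
  have hz : z ∈ T.nodes ∨ z ∈ p := by
    refine hs.mem_or_accepted.imp_right ?_
    rintro ⟨c, hc, -⟩
    by_contra hz
    rw [formed_eq_empty hz] at hc
    simp at hc
  refine ⟨?_, ?_, ?_, ?_, ?_⟩
  · intro a ha
    rw [hnodes]
    rcases (hmem a).1 ha with ha | ha
    · exact Or.inl (hT.fst_mem a ha)
    · exact Or.inr (Or.inl (fst_mem_of_mem_zip ha))
  · intro a ha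
    rw [hnodes]
    rcases (hmem a).1 ha with ha | ha
    · exact Or.inl (hT.snd_mem a ha)
    · exact Or.inr (snd_mem_of_mem_zip ha)
  · intro x hx
    have hx' : x ∈ T.nodes ∨ x ∈ p := by
      rcases (hnodes x).1 hx with hx | hx | rfl
      · exact Or.inl hx
      · exact Or.inr hx
      · exact hz
    rcases hx' with hx | hx
    · obtain ⟨y, hy, huniq⟩ := hT.existsUnique_out x hx
      refine ⟨y, (hmem _).2 (Or.inl hy), fun y' hy' => ?_⟩
      rcases (hmem _).1 hy' with hy' | hy'
      · exact huniq y' hy'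
      · exact absurd hx (hpT _ (fst_mem_of_mem_zip hy'))
    · obtain ⟨y, hy⟩ := exists_mem_zip z hx
      refine ⟨y, (hmem _).2 (Or.inr hy), fun y' hy' => ?_⟩
      rcases (hmem _).1 hy' with hy' | hy'
      · exact absurd (hT.fst_mem _ hy') (hpT _ hx)
      · exact zip_tail_functional hnd hy' hy
  · intro a ha
    rcases (hmem a).1 ha with ha | ha
    · exact hT.adj a ha
    · exact hadj a ha
  · intro x y hxy hyx
    rcases (hmem _).1 hxy with h1 | h1 <;> rcases (hmem _).1 hyx with h2 | h2
    · exact hT.asymm x y h1 h2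
    · exact hpT _ (fst_mem_of_mem_zip h2) (hT.snd_mem _ h1)
    · exact hpT _ (fst_mem_of_mem_zip h1) (hT.snd_mem _ h2)
    · obtain ⟨q, w, rfl⟩ := zip_asymm hnd (fun a ha => (hadj a ha).ne) h1 h2
      rcases hs.mem_or_accepted with hzT | ⟨c, hc, n, hn⟩
      · exact hpT z (by simp) hzT
      · have hzq : z ∉ q := fun h => (List.nodup_append.1 hnd).2.2 z h z (by simp) rfl
        rw [mem_formed, dropWhile_append_cons hzq] at hc
        rw [hb c n (alpha_backtrack φ hc)] at hn
        simp at hn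

/-- If every walk is stopped, the algorithm terminates and returns a forest. -/
lemma exists_returns (h0 : ∀ x, X x 0 = x) (φ : Connection G)
    (hX : ∀ x n, G.Adj (X x n) (X x (n + 1)))
    (hb : ∀ x c n, alpha φ c = 0 → b x c n = false)
    (hkilled : ∀ A : Finset V, ∀ x ∉ A, ∃ n, ¬ Alive A (X x) (b x) n) :
    ∃ F, IsOrientedCRSF G F ∧ Returns ι X b F := by
  have key : ∀ k l T, run ι X b l = some T → IsPartialForest G T → T.nodesᶜ.card ≤ k →
      ∃ l' T', run ι X b l' = some T' ∧ IsPartialForest G T' ∧ T'.nodes = Finset.univ := by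
    intro k
    induction k with
    | zero =>
      intro l T h1 h2 h3
      exact ⟨l, T, h1, h2, by simpa using h3⟩
    | succ k ih =>
      intro l T h1 h2 h3
      by_cases hT : T.nodes = Finset.univ
      · exact ⟨l, T, h1, h2, hT⟩
      · obtain ⟨x, hx⟩ := exists_firstMissing ι hT
        have hxT := firstMissing_eq_some ι hx
        obtain ⟨n, hn⟩ := hkilled T.nodes x hxT
        obtain ⟨p, z, hs⟩ := exists_stopsWith_of_not_alive (by rw [h0]; exact hxT) hn
        refine ih (l + 1) _ ((run_succ_eq_some h0).2 ⟨T, x, p, z, h1, hx, hs, rfl⟩)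
          (h2.union φ hs (hX x) (hb x)) ?_
        refine Nat.le_of_lt_succ (lt_of_lt_of_le (Finset.card_lt_card ?_) h3)
        rw [Finset.compl_ssubset_compl]
        refine (Finset.ssubset_iff_of_subset Finset.subset_union_left).2 ⟨x, ?_, hxT⟩
        refine Finset.mem_union_right _ ?_
        have hxp : x ∈ p := List.mem_of_mem_head? (by rw [hs.head, h0]; rfl)
        simp [ofPath, hxp]
  obtain ⟨l, ⟨N, F⟩, h1, h2, rfl⟩ := key _ 0 (OrientedSubgraph.empty V) rfl
    ⟨by simp [OrientedSubgraph.empty], by simp [OrientedSubgraph.empty],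
      by simp [OrientedSubgraph.empty], by simp [OrientedSubgraph.empty],
      by simp [OrientedSubgraph.empty]⟩ le_rfl
  refine ⟨F, ?_, l, h1⟩
  choose f hf hf' using fun x => h2.existsUnique_out x (Finset.mem_univ x)
  exact isOrientedCRSF_of_isGraphOf (f := f)
    (fun x y => ⟨fun h => (hf' x y h).symm, fun h => h ▸ hf x⟩) h2.adj h2.asymm

end Run

/-! ### The law of the stages -/

section StageLaw

variable {V : Type u} [Fintype V] [DecidableEq V] [MeasurableSpace V] [MeasurableSingletonClass V]
  {G : SimpleGraph V} {W : EdgeWeights G} {φ : Connection G} {Ω : Type v} [MeasurableSpace Ω]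
  {μ : Measure Ω} [IsProbabilityMeasure μ]
  {X : V → ℕ → Ω → V} {B : V → OrientedCycle G → ℕ → Ω → Bool} {ι : Fin (Fintype.card V) ≃ V}
  {F : Finset (V × V)} {f : V → V}

/-- The stages are independent branches of distinct walks, and the ratios of determinants
telescope. -/
lemma measureReal_run_eq_stage (hG : G.Connected) (hφ : Nontrivial φ)
    (hweak : WeaklyInconsistent φ) (h : IsDriving W φ μ X B) (hF : IsOrientedCRSF G F) {l : ℕ}
    (hl : l ≤ numStages ι F) :
    ((μ.real {ω | run ι (fun x n => X x n ω) (fun x c n => B x c n ω) l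
        = some (stage ι F l)} : ℝ) : ℂ) =
      (removeRowsCols (laplacian W φ) (stage ι F l).nodes).det / (laplacian W φ).det *
        forestWeight W φ (stage ι F l).arcs := by
  obtain ⟨f, hf⟩ := hF.exists_isGraphOf
  have hex : ∀ j, ∃ x p z, j < l → firstMissing ι (stage ι F j).nodes = some x ∧
      IsBranch F (stage ι F j).nodes x p z := by
    intro j
    by_cases hj : j < l
    · obtain ⟨x, hx⟩ := exists_firstMissing_stage ι (hj.trans_le hl)
      obtain ⟨p, z, hb⟩ := exists_isBranch hf (firstMissing_eq_some ι hx)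
      exact ⟨x, p, z, fun _ => ⟨hx, hb⟩⟩
    · obtain ⟨x⟩ := hG.nonempty
      exact ⟨x, [], x, fun h => absurd h hj⟩
  choose x p z hxpz using hex
  have hx := fun j hj => (hxpz j hj).1
  have hb := fun j hj => (hxpz j hj).2
  -- each walk is used once, since its starting node is covered at all later stages
  have hinj : Function.Injective fun j : Fin l => x j := by
    have hlt : ∀ i j : Fin l, i < j → x i ≠ x j := by
      intro i j hij heq
      refine firstMissing_eq_some ι (hx j j.2) ?_
      rw [← heq]
      exact stage_mono ι F (Nat.succ_le_of_lt hij) (mem_stage_succ ι (hx i i.2))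
    intro i j hij
    rcases lt_trichotomy i j with h' | h' | h'
    · exact absurd hij (hlt i j h')
    · exact h'
    · exact absurd hij.symm (hlt j i h')
  have hformed : ∀ j < l, z j ∈ (stage ι F j).nodes ∨ (formed G (p j) (z j)).Nonempty := by
    intro j hj
    refine (hb j hj).closes.imp_right fun hz => ?_
    obtain ⟨m, hm, hd⟩ := eq_takeWhile_append (p j) (z j) hz
    have hnd := (hb j hj).nodup
    rw [hm, List.nodup_append] at hnd
    obtain ⟨c, hc⟩ := exists_orientedCycle (G := G) hnd.2.1 fun a ha =>
      hF.adj a ((hb j hj).arcs a (by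
        rw [hm, zip_append_right]
        exact List.mem_append_right _ ha))
    exact ⟨c, mem_formed.2 (by rw [hc, hd])⟩
  have hset : {ω | run ι (fun x n => X x n ω) (fun x c n => B x c n ω) l = some (stage ι F l)} =ᵐ[μ]
      ⋂ j ∈ (Finset.univ : Finset (Fin l)), nodeData X B (x j) ⁻¹'
        {q | StopsWith (stage ι F j).nodes q.1 q.2 (p j) (z j)} := by
    filter_upwards [ae_start h] with ω hω
    refine propext ?_
    change run ι (fun x n => X x n ω) (fun x c n => B x c n ω) l = some (stage ι F l) ↔
      ω ∈ ⋂ j ∈ (Finset.univ : Finset (Fin l)), nodeData X B (x j) ⁻¹'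
        {q | StopsWith (stage ι F j).nodes q.1 q.2 (p j) (z j)}
    rw [run_eq_stage_iff_stopsWith hf hω hx hb]
    simp only [Set.mem_iInter, Finset.mem_univ, true_imp_iff]
    exact ⟨fun h' j => h' j j.2, fun h' j hj => h' ⟨j, hj⟩⟩
  have hprod := (h.indep_nodes.precomp hinj).measure_inter_preimage_eq_mul Finset.univ
    (sets := fun j : Fin l => {q | StopsWith (stage ι F j).nodes q.1 q.2 (p j) (z j)})
    (fun j _ => measurableSet_stopsWith _ _ _)
  have hreal : μ.real {ω | run ι (fun x n => X x n ω) (fun x c n => B x c n ω) l =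
      some (stage ι F l)} = ∏ j ∈ Finset.range l,
        μ.real {ω | StopsWith (stage ι F j).nodes (fun i => X (x j) i ω)
          (fun c i => B (x j) c i ω) (p j) (z j)} := by
    rw [measureReal_congr hset, ← Fin.prod_univ_eq_prod_range (fun j =>
      μ.real {ω | StopsWith (stage ι F j).nodes (fun i => X (x j) i ω)
          (fun c i => B (x j) c i ω) (p j) (z j)}) l]
    have := congrArg ENNReal.toReal hprod
    rw [ENNReal.toReal_prod] at this
    exact this
  rw [hreal]
  clear hreal hprod hset hinj
  induction l with
  | zero =>
    have hdet : (laplacian W φ).det ≠ 0 := by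
      rw [← coe_removedDet_empty hG W φ hφ]
      exact_mod_cast (removedDet_pos hG W φ hφ ∅).ne'
    have hcyc : ∀ c : OrientedCycle G, ¬ c.IsIn ∅ := by
      intro c hc
      obtain ⟨v, hv⟩ := c.exists_mem
      obtain ⟨m, hm, hb⟩ := hc.exists_isBranch hv
      obtain ⟨w, hw⟩ := exists_mem_zip v (List.mem_cons_self (a := v) (l := m))
      exact absurd (hb.arcs _ hw) (Finset.notMem_empty _)
    rw [show stage ι F 0 = ⟨∅, ∅⟩ from rfl, det_removeRowsCols_empty, div_self hdet]
    simp [forestWeight, hcyc]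
  | succ l ih =>
    have hl' := l.lt_succ_self
    rw [Finset.prod_range_succ, Complex.ofReal_mul,
      ih (Nat.le_of_succ_le hl) (fun j hj => hxpz j (hj.trans hl')) (fun j hj => hx j (hj.trans hl'))
        (fun j hj => hb j (hj.trans hl')) (fun j hj => hformed j (hj.trans hl')),
      measureReal_stopsWith hG hφ hweak h (mem_paths.2 ⟨(hb l hl').nodup, (hb l hl').notMem⟩)
        (hb l hl').head (hformed l hl'), stage_succ_eq ι hf (hx l hl') (hb l hl'),
      (hb l hl').forestWeight_eq W φ hf (stage_image_mem ι hf l),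
      show (outSubgraph F ((stage ι F l).nodes ∪ (p l).toFinset)).nodes =
        (stage ι F l).nodes ∪ (p l).toFinset from rfl, ← stage_eq ι hf l]
    have hne : (removedDet W φ (stage ι F l).nodes : ℂ) ≠ 0 := by
      exact_mod_cast (removedDet_pos hG W φ hφ _).ne'
    rw [Complex.ofReal_mul, Complex.ofReal_div, ← coe_removedDet hG W φ hφ,
      ← coe_removedDet hG W φ hφ]
    field_simp

end StageLaw

end CyclePopping

end

open CyclePopping in
theorem proposition4p3 {V : Type*} [Fintype V] [DecidableEq V]
    [MeasurableSpace V] [MeasurableSingletonClass V]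
    (G : SimpleGraph V) (hG : G.Connected)
    (W : CyclePopping.EdgeWeights G) (φ : CyclePopping.Connection G)
    (hnontrivial : CyclePopping.Nontrivial φ) (hweak : CyclePopping.WeaklyInconsistent φ)
    (ι : Fin (Fintype.card V) ≃ V)
    {Ω : Type*} [MeasurableSpace Ω] (μ : Measure Ω) [IsProbabilityMeasure μ]
    (X : V → ℕ → Ω → V) (B : V → CyclePopping.OrientedCycle G → ℕ → Ω → Bool)
    (hXB : CyclePopping.IsDriving W φ μ X B) :
    -- the normalization is not degenerate
    (CyclePopping.laplacian W φ).det ≠ 0 ∧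
    -- the law of the stages
    (∀ F : Finset (V × V), CyclePopping.IsOrientedCRSF G F → CyclePopping.crsfMeasure W φ F ≠ 0 →
      ∀ l : ℕ, 1 ≤ l → l ≤ CyclePopping.numStages ι F →
        μ {ω | CyclePopping.run ι (fun x n => X x n ω) (fun x c n => B x c n ω) l
            = some (CyclePopping.stage ι F l)} =
          μ {ω | ∀ j, 1 ≤ j → j ≤ l →
            CyclePopping.run ι (fun x n => X x n ω) (fun x c n => B x c n ω) j
              = some (CyclePopping.stage ι F j)} ∧
        ((μ.real {ω | ∀ j, 1 ≤ j → j ≤ l →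
            CyclePopping.run ι (fun x n => X x n ω) (fun x c n => B x c n ω) j
              = some (CyclePopping.stage ι F j)} : ℝ) : ℂ) =
          (CyclePopping.removeRowsCols (CyclePopping.laplacian W φ)
              (CyclePopping.stage ι F l).nodes).det / (CyclePopping.laplacian W φ).det *
            CyclePopping.forestWeight W φ (CyclePopping.stage ι F l).arcs) ∧
    -- almost surely, the algorithm terminates and its output is an oriented CRSF
    (∀ᵐ ω ∂μ, ∃ F : Finset (V × V), CyclePopping.IsOrientedCRSF G F ∧
      CyclePopping.Returns ι (fun x n => X x n ω) (fun x c n => B x c n ω) F) ∧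
    -- the law of the output
    (∀ F : Finset (V × V), CyclePopping.IsOrientedCRSF G F →
      ((μ.real {ω | CyclePopping.Returns ι (fun x n => X x n ω) (fun x c n => B x c n ω) F} : ℝ) : ℂ)
        = CyclePopping.crsfMeasure W φ F) := by
  refine ⟨?_, ?_, ?_, ?_⟩
  · rw [← coe_removedDet_empty hG W φ hnontrivial]
    exact_mod_cast (removedDet_pos hG W φ hnontrivial ∅).ne'
  · intro F hF _ l _ hl
    obtain ⟨f, hf⟩ := hF.exists_isGraphOf
    have hset : {ω | run ι (fun x n => X x n ω) (fun x c n => B x c n ω) l = some (stage ι F l)}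
        =ᵐ[μ] {ω | ∀ j, 1 ≤ j → j ≤ l →
          run ι (fun x n => X x n ω) (fun x c n => B x c n ω) j = some (stage ι F j)} := by
      filter_upwards [ae_start hXB] with ω hω
      exact propext (run_eq_stage_iff_forall hf hω l)
    refine ⟨measure_congr hset, ?_⟩
    rw [← measureReal_congr hset]
    exact measureReal_run_eq_stage hG hnontrivial hweak hXB hF hl
  · have hkilled : ∀ᵐ ω ∂μ, ∀ A : Finset V, ∀ x, x ∉ A →
        ∃ n, ¬ Alive A (fun i => X x i ω) (fun c i => B x c i ω) n := by
      rw [ae_all_iff]; intro A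
      rw [ae_all_iff]; intro x
      by_cases hx : x ∈ A
      · exact Filter.Eventually.of_forall fun ω h => absurd hx h
      · filter_upwards [ae_exists_not_alive hG hnontrivial hweak hXB hx] with ω hω _ using hω
    filter_upwards [hkilled, ae_start hXB, ae_step_adj hXB, ae_bit_false hXB] with ω h1 h2 h3 h4
    exact exists_returns h2 φ h3 h4 h1
  · intro F hF
    obtain ⟨f, hf⟩ := hF.exists_isGraphOf
    have hset : {ω | Returns ι (fun x n => X x n ω) (fun x c n => B x c n ω) F} =ᵐ[μ]
        {ω | run ι (fun x n => X x n ω) (fun x c n => B x c n ω) (numStages ι F) =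
          some (stage ι F (numStages ι F))} := by
      filter_upwards [ae_start hXB] with ω hω
      exact propext (returns_iff hf hω)
    rw [measureReal_congr hset, measureReal_run_eq_stage hG hnontrivial hweak hXB hF le_rfl,
      stage_numStages_eq ι hf, ← coe_removedDet hG W φ hnontrivial, removedDet_univ, crsfMeasure,
      Complex.ofReal_one]
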